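/- Let $\mathcal F$ be the Fourier transformation on $L^2(\mathbb R)$, and let the Hardy space $H_+\subset L^2(\mathbb R)$ be the image under $\mathcal F^{-1}$ of the functions that vanish a.e. on $]-\infty,0]$, where $(\mathcal F^{-1}g)(x)=(2\pi)^{-1/2}\int e^{ixy}g(y)\,dy$. For measurable $\kappa:\mathbb R\to\mathbb C$ let $M_+(\kappa)$ be the operator in $H_+$ with domain $\{h\in H_+:\kappa h\in L^2(\mathbb R)\}$ given by $M_+(\kappa)h:=P_{H_+}(\kappa h)$, where $P_{H_+}$ is the orthogonal projection of $L^2(\mathbb R)$ on $H_+$. Let $P,Q$ be complex polynomials without common zeros, $Q\neq0$, and let $\kappa=P/Q$ on $\mathbb R$ (off the real zeros of $Q$). Let $\kappa(\mathbb R):=\{P(x)/Q(x):x\in\mathbb R,\ Q(x)\ne0\}$. Let $\lambda\in\mathbb C$ and put $P^\lambda:=P-\lambda Q$. For a polynomial $R\ne0$ let $\deg R_>$, $\deg R_\ge$, $\deg R_<$, $\deg R_\le$ denote the number of zeros of $R$, counted with multiplicity, in the open upper, closed upper, open lower and closed lower half-plane, respectively; for $R=0$ these numbers are set to be $0$. Then,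 referring to the operator $M_+(\kappa)$ in $H_+$: 1. $\lambda$ is a Fredholm point (i.e. $M_+(\kappa)-\lambda I$ is a Fredholm operator: densely defined and closed, with finite-dimensional kernel and cokernel, and with closed range) iff $\lambda\notin\overline{\kappa(\mathbb R)}$. If $\lambda$ is a Fredholm point, then $$\dim\ker(M_+(\kappa)-\lambda I)=\max\{0,\deg Q_>-\deg P^\lambda_>\},$$ $$\dim\operatorname{ran}(M_+(\kappa)-\lambda I)^\perp=\max\{0,\deg P^\lambda_>-\deg Q_>\},$$ $$\operatorname{ind}(M_+(\kappa)-\lambda I)=\deg Q_>-\deg P^\lambda_>,$$ where the index is the dimension of the kernel minus the dimension of the cokernel. 2. $\lambda$ is a regular value (i.e. $M_+(\kappa)-\lambda I$ is injective and its inverse, defined on its range, is continuous) iff $\lambda\notin\overline{\kappa(\mathbb R)}$ and $\deg Q_>\le\deg P^\lambda_>$. 3. $\lambda$ is in the resolvent set (i.e. $M_+(\kappa)-\lambda I$ is a bijection of its domain onto $H_+$ with continuous inverse) iff $\lambda\notin\overline{\kappa(\mathbb R)}$ and $\deg Q_>=\deg P^\lambda_>$. 4. $\lambda$ is a spectral value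 (i.e. not in the resolvent set) iff $\lambda\in\overline{\kappa(\mathbb R)}$ or $\deg Q_>\ne\deg P^\lambda_>$. 5. $\lambda$ is in the point spectrum (i.e. is an eigenvalue) iff either $P^\lambda=0$ or both $\deg Q_\le<\deg P^\lambda_<$ and $\deg P^\lambda_\ge<\deg Q_>$. 6. $\lambda$ is in the continuous spectrum (i.e. $M_+(\kappa)-\lambda I$ is injective with dense, not closed range) iff $P^\lambda\ne0$, $\lambda\in\overline{\kappa(\mathbb R)}$, $\deg P^\lambda_>\le\deg Q_>$, and at least one of $\deg P^\lambda_<\le\deg Q_\le$ and $\deg Q_>\le\deg P^\lambda_\ge$ holds. 7. $\lambda$ is in the residual spectrum (i.e. $M_+(\kappa)-\lambda I$ is injective with range not dense) iff $\deg Q_><\deg P^\lambda_>$. -/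

import Mathlib

open MeasureTheory Polynomial

noncomputable section

namespace WienerHopf

/-- The Hilbert space `L²(ℝ)`. -/
abbrev L2R : Type := Lp ℂ 2 (volume : Measure ℝ)

/-- `L²(0, ∞)`, embedded in `L²(ℝ)` by extension by zero: the functions that vanish a.e. on
`(-∞, 0]`. -/
def halfLine : Submodule ℂ L2R :=
  LinearMap.ker (LpToLpRestrictCLM ℝ ℂ ℂ (volume : Measure ℝ) 2 (Set.Iic 0)).toLinearMap

/-- The Hardy space `H₊`, the image of `L²(0, ∞)` under the inverse Fourier transformation.
Mathlib's inverse transformation has the kernel `exp (2 π i x y)`. It differs from the one with the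
kernel `(2 π)^(-1/2) exp (i x y)` by a unitary dilation, which maps `L²(0, ∞)` onto itself, so that
the image is the same for both normalizations. -/
def hardyPlus : Submodule ℂ L2R :=
  halfLine.map (Lp.fourierTransformₗᵢ ℝ ℂ).symm.toLinearEquiv.toLinearMap

theorem isClosed_hardyPlus : IsClosed (hardyPlus : Set L2R) := by
  have h : (hardyPlus : Set L2R) = (Lp.fourierTransformₗᵢ ℝ ℂ).symm '' (halfLine : Set L2R) := by
    ext x
    simp [hardyPlus]
  rw [h]
  exact (Lp.fourierTransformₗᵢ ℝ ℂ).symm.toHomeomorph.isClosedMap _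
    (ContinuousLinearMap.isClosed_ker _)

instance : CompleteSpace hardyPlus := isClosed_hardyPlus.completeSpace_coe

/-- The maximal multiplication operator `M(κ)` in `L²(ℝ)`, with the domain of all `f ∈ L²(ℝ)` such
that `κ f ∈ L²(ℝ)`. -/
def mulOp (κ : ℝ → ℂ) : L2R →ₗ.[ℂ] L2R where
  domain :=
    { carrier := {f | MemLp (fun x => κ x * f x) 2 (volume : Measure ℝ)}
      zero_mem' := by
        refine (memLp_congr_ae ?_).2 (MemLp.zero (ε := ℂ))
        filter_upwards [Lp.coeFn_zero ℂ 2 (volume : Measure ℝ)] with x hx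
        rw [hx, Pi.zero_apply, mul_zero]
      add_mem' := by
        intro f g hf hg
        refine (memLp_congr_ae ?_).2 (MemLp.add hf hg)
        filter_upwards [Lp.coeFn_add f g] with x hx
        rw [hx, Pi.add_apply, mul_add]
        rfl
      smul_mem' := by
        intro c f hf
        refine (memLp_congr_ae ?_).2 (MemLp.const_smul hf c)
        filter_upwards [Lp.coeFn_smul c f] with x hx
        simp only [hx, Pi.smul_apply, smul_eq_mul]
        ring }
  toFun :=
    { toFun := fun f => MemLp.toLp (fun x => κ x * (f : L2R) x) f.2
      map_add' := by
        intro f g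
        rw [← MemLp.toLp_add]
        apply MemLp.toLp_congr
        filter_upwards [Lp.coeFn_add (f : L2R) (g : L2R)] with x hx
        rw [Submodule.coe_add, hx, Pi.add_apply, mul_add]
        rfl
      map_smul' := by
        intro c f
        rw [RingHom.id_apply, ← MemLp.toLp_const_smul]
        apply MemLp.toLp_congr
        filter_upwards [Lp.coeFn_smul c (f : L2R)] with x hx
        simp only [Submodule.coe_smul, hx, Pi.smul_apply, smul_eq_mul]
        ring }

/-- The operator `M₊(κ) = P M(κ) P*` in `H₊`, where `P` is the orthogonal projection of `L²(ℝ)` on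
`H₊`: its domain is `{h ∈ H₊ : κ h ∈ L²(ℝ)}`, and it maps `h` to `P (κ h)`. -/
def mPlus (κ : ℝ → ℂ) : hardyPlus →ₗ.[ℂ] hardyPlus where
  domain := (mulOp κ).domain.comap hardyPlus.subtype
  toFun :=
    { toFun := fun h => hardyPlus.orthogonalProjectionOnto (mulOp κ ⟨((h : hardyPlus) : L2R), h.2⟩)
      map_add' := by
        intro f g
        rw [← map_add, ← LinearPMap.map_add]
        rfl
      map_smul' := by
        intro c f
        rw [RingHom.id_apply, ← map_smul, ← LinearPMap.map_smul]
        rfl }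

section Operators

variable {H : Type*} [NormedAddCommGroup H] [InnerProductSpace ℂ H]

/-- The operator `T - z I`, with the domain of `T`. -/
def shift (T : H →ₗ.[ℂ] H) (z : ℂ) : H →ₗ.[ℂ] H where
  domain := T.domain
  toFun := T.toFun - z • T.domain.subtype

/-- The kernel of `T`, as a subspace of the domain of `T`. -/
abbrev kernel (T : H →ₗ.[ℂ] H) : Submodule ℂ T.domain := LinearMap.ker T.toFun

/-- The range of `T`. -/
abbrev range (T : H →ₗ.[ℂ] H) : Submodule ℂ H := LinearMap.range T.toFun

/-- A Fredholm operator: densely defined and closed, with finite dimensional kernel and cokernel,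
and with closed range. -/
structure IsFredholm (T : H →ₗ.[ℂ] H) : Prop where
  dense_domain : Dense (T.domain : Set H)
  closed : T.IsClosed
  finite_kernel : FiniteDimensional ℂ (kernel T)
  finite_cokernel : FiniteDimensional ℂ (H ⧸ range T)
  closed_range : IsClosed (range T : Set H)

/-- The index: the dimension of the kernel minus the dimension of the cokernel. -/
def index (T : H →ₗ.[ℂ] H) : ℤ :=
  (Module.finrank ℂ (kernel T) : ℤ) - (Module.finrank ℂ (H ⧸ range T) : ℤ)

/-- `z` is a Fredholm point of `T`. -/
def IsFredholmPoint (T : H →ₗ.[ℂ] H) (z : ℂ) : Prop :=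
  IsFredholm (shift T z)

/-- `z` is a regular value of `T`: the operator `T - z I` is injective, and its inverse, defined on
the range of `T - z I`, is continuous. -/
def IsRegularValue (T : H →ₗ.[ℂ] H) (z : ℂ) : Prop :=
  kernel (shift T z) = ⊥ ∧ Continuous fun y : (shift T z).inverse.domain => (shift T z).inverse y

/-- The resolvent set: `T - z I` is a bijection of the domain onto the whole space with a
continuous inverse. -/
def resolventSet (T : H →ₗ.[ℂ] H) : Set ℂ :=
  {z | IsRegularValue T z ∧ range (shift T z) = ⊤}

/-- The spectrum, the complement of the resolvent set. -/
def spectrum (T : H →ₗ.[ℂ] H) : Set ℂ := (resolventSet T)ᶜ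

/-- The point spectrum, the set of all eigenvalues. -/
def pointSpectrum (T : H →ₗ.[ℂ] H) : Set ℂ :=
  {z | ∃ f : T.domain, f ≠ 0 ∧ T f = z • (f : H)}

/-- The continuous spectrum: `T - z I` is injective, and its range is dense and not closed. -/
def continuousSpectrum (T : H →ₗ.[ℂ] H) : Set ℂ :=
  {z | kernel (shift T z) = ⊥ ∧ Dense (range (shift T z) : Set H) ∧
    ¬ IsClosed (range (shift T z) : Set H)}

/-- The residual spectrum: `T - z I` is injective, and its range is not dense. -/
def residualSpectrum (T : H →ₗ.[ℂ] H) : Set ℂ :=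
  {z | kernel (shift T z) = ⊥ ∧ ¬ Dense (range (shift T z) : Set H)}

end Operators

/-- The rational symbol `κ = P / Q` on `ℝ`. The finitely many real zeros of `Q` form a null set, so
the values that are assigned there do not affect `M₊(κ)`. -/
def ratSymbol (P Q : ℂ[X]) (x : ℝ) : ℂ := P.eval (x : ℂ) / Q.eval (x : ℂ)

/-- The set `κ(ℝ)` of the values of `κ = P / Q` at the real points that are not zeros of `Q`. -/
def ratRange (P Q : ℂ[X]) : Set ℂ :=
  {w | ∃ x : ℝ, Q.eval (x : ℂ) ≠ 0 ∧ ratSymbol P Q x = w}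

open scoped Classical in
/-- The monic polynomial whose zeros are the zeros of `P` in `S`, with the multiplicities they have
in `P`. -/
def partIn (S : Set ℂ) (P : ℂ[X]) : ℂ[X] :=
  ((P.roots.filter (· ∈ S)).map fun a => X - C a).prod

/-- `deg P_>`: zeros in the open upper half-plane. -/
def degGT (P : ℂ[X]) : ℕ := (partIn {a | 0 < a.im} P).natDegree

/-- `deg P_≥`: zeros in the closed upper half-plane. -/
def degGE (P : ℂ[X]) : ℕ := (partIn {a | 0 ≤ a.im} P).natDegree

/-- `deg P_<`: zeros in the open lower half-plane. -/
def degLT (P : ℂ[X]) : ℕ := (partIn {a | a.im < 0} P).natDegree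

/-- `deg P_≤`: zeros in the closed lower half-plane. -/
def degLE (P : ℂ[X]) : ℕ := (partIn {a | a.im ≤ 0} P).natDegree

end WienerHopf

end

/-!
The proof is a Wiener-Hopf factorization, carried out with explicit rational functions.

Write `κ - z = R / Q` with `R = P - z Q`, and assume `R ≠ 0`. Let `D` be the product of the
factors `(x - a) / (x + i)` over the real zeros `a` of `Q` and of the factors `1 / (x + i)` that
account for a pole of `κ - z` at infinity. Then `ψ = (κ - z) D` is a bounded symbol. Since `D` and
`ψ` have no common zero in `ℝ ∪ {∞}`, they generate the unit ideal among the bounded continuous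
functions, and it follows (`factorsThrough_of_symbol`) that the domain of `M₊(κ)` is `D H₊` and
that `M₊(κ) - z` maps `D u` to `P_{H₊} (ψ u)`. The change of variables `h = D u` is injective with
dense range, because `D` is an outer function (`isOuter_fac`, `isOuter_res`). All questions are
thus reduced to the bounded Toeplitz operator with the symbol `ψ`.

Sorting the zeros and poles by half-planes gives `ψ = A₁ w ^ r (1 / w) ^ s A₂ B`
(`exists_wienerHopfModel`). Here `w = (x - i) / (x + i)`, the numbers `r` and `s` count the zeros
of `R` and of `Q` in the open upper half-plane, `A₁` and `A₂` are invertible symbols, analytic in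
the lower and in the upper half-plane, and the outer function `B` collects the `b` zeros of
`κ - z` in `ℝ ∪ {∞}`. Toeplitz operators are multiplicative along such a product, so that the
operator is the product of an invertible operator, the isometry `w ^ (r - s)` or the adjoint of
the isometry `w ^ (s - r)`, an invertible operator, and the multiplication by `B`. The adjoint of
`w ^ k` is surjective, and its kernel consists of the functions `p / (x + i) ^ k` with `deg p < k`
(`finrank_ker_coBlaschkeOp_pow`, `exists_polynomial_of_coBlaschkeOp_pow_eq_zero`). The
multiplication by `B` is injective with dense range, and it is bounded below only if `b = 0`
(`not_bounded_below_outerFactor`). From this one reads off that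
* the range is dense if and only if `r ≤ s` (`WienerHopfModel.dense_range_iff`),
* the kernel is not trivial if and only if `b + r < s` (`WienerHopfModel.kernel_ne_bot_iff`),
* the range is closed, and the operator is Fredholm, if and only if `b = 0`
  (`WienerHopfModel.eq_zero_of_isClosed_range`, `WienerHopfModel.fredholm`),
* `b = 0` if and only if `z` is not in the closure of the range of `κ`
  (`notMem_closure_ratRange_iff`),
and the assertions of the theorem are combinations of these facts.

The only analytic input about `H₊` is that it contains the Cauchy kernels `1 / (x - a)` with
`Im a < 0`, that they are total in it, and that the kernels with `Im a > 0` are orthogonal to it.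
All of this is seen from the Fourier integrals of exponentials on half-lines. By partial fractions
it follows that `1 / (x - a)` is a multiplier of `H₊` if `Im a < 0` (`res_mem_plusAlg`).
-/

noncomputable section

namespace WienerHopf

/-! ### Cauchy kernels in the Hardy space -/

section Fourier

open FourierTransform SchwartzMap

theorem flip_neg_innerₗ : (-innerₗ ℝ : ℝ →ₗ[ℝ] ℝ →ₗ[ℝ] ℝ).flip = -innerₗ ℝ := by
  ext
  simp

/-- On `L¹ ∩ L²` the inverse Fourier transformation of `L²(ℝ)` is given by the Fourier integral. -/
theorem fourierInv_toLp_ae_eq {g : ℝ → ℂ} (h1 : Integrable g) (h2 : MemLp g 2) :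
    (𝓕⁻ (h2.toLp g) : L2R) =ᵐ[volume] (𝓕⁻ g : ℝ → ℂ) := by
  have hc : Continuous (𝓕⁻ g : ℝ → ℂ) := by
    have := VectorFourier.fourierIntegral_continuous (V := ℝ) (W := ℝ) (e := Real.fourierChar)
      (L := -innerₗ ℝ) Real.continuous_fourierChar
      (continuous_inner (𝕜 := ℝ) (E := ℝ)).neg h1
    convert! this using 1
  refine ae_eq_of_integral_contDiff_smul_eq
    ((Lp.memLp (𝓕⁻ (h2.toLp g) : L2R)).locallyIntegrable (by norm_num)) hc.locallyIntegrable ?_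
  intro φ hφ hφc
  have hφ' : ContDiff ℝ (⊤ : ℕ∞) (fun x => (φ x : ℂ)) := Complex.ofRealCLM.contDiff.comp hφ
  have hcs : HasCompactSupport (fun x => (φ x : ℂ)) := hφc.comp_left Complex.ofReal_zero
  let Φ : 𝓢(ℝ, ℂ) := hcs.toSchwartzMap hφ'
  have hΦ : ∀ x, Φ x = (φ x : ℂ) := fun x => rfl
  have key : (∫ x, Φ x • (𝓕⁻ (h2.toLp g) : L2R) x) = ∫ x, Φ x • (𝓕⁻ g : ℝ → ℂ) x := by
    rw [← Lp.toTemperedDistribution_apply, ← Lp.fourierInv_toTemperedDistribution_eq,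
      TemperedDistribution.fourierInv_apply, Lp.toTemperedDistribution_apply]
    have e1 : (∫ x, (𝓕⁻ Φ) x • (h2.toLp g) x) = ∫ x, (𝓕⁻ Φ) x • g x := by
      apply integral_congr_ae
      filter_upwards [h2.coeFn_toLp] with x hx
      rw [hx]
    rw [e1, SchwartzMap.fourierInv_coe]
    have := VectorFourier.integral_fourierIntegral_smul_eq_flip (V := ℝ) (W := ℝ)
      (e := Real.fourierChar) (μ := volume) (ν := volume)
      (L := -innerₗ ℝ) (f := Φ) (g := g) Real.continuous_fourierChar
      (continuous_inner (𝕜 := ℝ) (E := ℝ)).neg Φ.integrable h1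
    rw [flip_neg_innerₗ] at this
    exact this
  simpa [hΦ] using key

theorem mem_hardyPlus_iff (f : L2R) : f ∈ hardyPlus ↔ (𝓕 f : L2R) ∈ halfLine := by
  unfold hardyPlus
  rw [Submodule.mem_map]
  constructor
  · rintro ⟨g, hg, rfl⟩
    have : (𝓕 ((Lp.fourierTransformₗᵢ ℝ ℂ).symm g) : L2R) = g :=
      (Lp.fourierTransformₗᵢ ℝ ℂ).apply_symm_apply g
    simpa [this] using! hg
  · intro h
    exact ⟨𝓕 f, h, (Lp.fourierTransformₗᵢ ℝ ℂ).symm_apply_apply f⟩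

theorem fourierInv_mem_hardyPlus {g : L2R} (hg : g ∈ halfLine) : (𝓕⁻ g : L2R) ∈ hardyPlus := by
  rw [mem_hardyPlus_iff, fourier_fourierInv_eq]
  exact hg

theorem mem_halfLine_iff (f : L2R) :
    f ∈ halfLine ↔ ∀ᵐ x ∂(volume : Measure ℝ), x ≤ 0 → f x = 0 := by
  unfold halfLine
  rw [LinearMap.mem_ker]
  have h := LpToLpRestrictCLM_coeFn (F := ℂ) ℂ (Set.Iic (0:ℝ)) f (μ := volume)
  change _ ↔ ∀ᵐ x ∂(volume : Measure ℝ), x ∈ Set.Iic (0:ℝ) → f x = 0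
  rw [← ae_restrict_iff' (s := Set.Iic (0:ℝ)) (p := fun x => f x = 0) measurableSet_Iic]
  constructor
  · intro h0
    have h0' : (LpToLpRestrictCLM ℝ ℂ ℂ (volume : Measure ℝ) 2 (Set.Iic 0)) f = 0 := h0
    rw [h0'] at h
    filter_upwards [h, Lp.coeFn_zero ℂ 2 (volume.restrict (Set.Iic (0:ℝ)))] with x h1 h2
    rw [← h1, h2]; rfl
  · intro h0
    change (LpToLpRestrictCLM ℝ ℂ ℂ (volume : Measure ℝ) 2 (Set.Iic 0)) f = 0
    rw [Lp.eq_zero_iff_ae_eq_zero]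
    filter_upwards [h, h0] with x h1 h2
    rw [h1, h2]; rfl

/-- The function whose inverse Fourier integral is `x ↦ (x - a)⁻¹`: an exponential, cut off to the
half-line on which it decays. -/
def expKernel (a : ℂ) : ℝ → ℂ :=
  if a.im < 0 then
    (Set.Ioi 0).indicator fun y => -(2 * Real.pi * Complex.I) *
      Complex.exp (-(2 * Real.pi * Complex.I) * a * y)
  else
    (Set.Iic 0).indicator fun y => (2 * Real.pi * Complex.I) *
      Complex.exp (-(2 * Real.pi * Complex.I) * a * y)

theorem integrable_expKernel {a : ℂ} (ha : a.im ≠ 0) : Integrable (expKernel a) := by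
  unfold expKernel
  split_ifs with h
  · rw [integrable_indicator_iff measurableSet_Ioi]
    apply Integrable.const_mul
    apply integrableOn_exp_mul_complex_Ioi
    simp
    nlinarith [Real.pi_pos]
  · rw [integrable_indicator_iff measurableSet_Iic]
    apply Integrable.const_mul
    apply integrableOn_exp_mul_complex_Iic
    have : 0 < a.im := lt_of_le_of_ne (not_lt.1 h) ha.symm
    simp
    nlinarith [Real.pi_pos, mul_pos Real.pi_pos this]

theorem memLp_expKernel {a : ℂ} (ha : a.im ≠ 0) : MemLp (expKernel a) 2 := by
  rw [memLp_two_iff_integrable_sq_norm (integrable_expKernel ha).1]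
  have e : ∀ y : ℝ, ‖Complex.exp (-(2 * Real.pi * Complex.I) * a * y)‖ ^ 2
      = Real.exp ((4 * Real.pi * a.im) * y) := by
    intro y
    rw [Complex.norm_exp, ← Real.exp_nat_mul]
    congr 1
    simp
    ring
  unfold expKernel
  split_ifs with h
  · have : (fun y => ‖(Set.Ioi (0:ℝ)).indicator (fun y : ℝ => -(2 * Real.pi * Complex.I) *
      Complex.exp (-(2 * Real.pi * Complex.I) * a * y)) y‖ ^ 2) = (Set.Ioi (0:ℝ)).indicator
        (fun y : ℝ => (2 * Real.pi) ^ 2 * Real.exp ((4 * Real.pi * a.im) * y)) := by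
      ext y
      by_cases hy : y ∈ Set.Ioi (0:ℝ)
      · rw [Set.indicator_of_mem hy, Set.indicator_of_mem hy, norm_mul, mul_pow, e]
        simp [abs_of_pos Real.pi_pos]
      · rw [Set.indicator_of_notMem hy, Set.indicator_of_notMem hy]; simp
    rw [this, integrable_indicator_iff measurableSet_Ioi]
    apply Integrable.const_mul
    apply integrableOn_exp_mul_Ioi
    nlinarith [Real.pi_pos]
  · have : (fun y => ‖(Set.Iic (0:ℝ)).indicator (fun y : ℝ => (2 * Real.pi * Complex.I) *
      Complex.exp (-(2 * Real.pi * Complex.I) * a * y)) y‖ ^ 2) = (Set.Iic (0:ℝ)).indicator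
        (fun y : ℝ => (2 * Real.pi) ^ 2 * Real.exp ((4 * Real.pi * a.im) * y)) := by
      ext y
      by_cases hy : y ∈ Set.Iic (0:ℝ)
      · rw [Set.indicator_of_mem hy, Set.indicator_of_mem hy, norm_mul, mul_pow, e]
        simp [abs_of_pos Real.pi_pos]
      · rw [Set.indicator_of_notMem hy, Set.indicator_of_notMem hy]; simp
    rw [this, integrable_indicator_iff measurableSet_Iic]
    apply Integrable.const_mul
    apply integrableOn_exp_mul_Iic
    have : 0 < a.im := lt_of_le_of_ne (not_lt.1 h) ha.symm
    have := Real.pi_pos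
    positivity

theorem ofReal_sub_ne_zero {a : ℂ} (ha : a.im ≠ 0) (x : ℝ) : (x : ℂ) - a ≠ 0 := by
  intro h
  apply ha
  rw [← sub_eq_zero.1 h]
  simp

theorem fourierInv_expKernel {a : ℂ} (ha : a.im ≠ 0) (x : ℝ) :
    (𝓕⁻ (expKernel a) : ℝ → ℂ) x = ((x : ℂ) - a)⁻¹ := by
  have hp : (2 * Real.pi * Complex.I : ℂ) ≠ 0 := by
    simp [Real.pi_ne_zero]
  have hx := ofReal_sub_ne_zero ha x
  rw [Real.fourierInv_eq']
  unfold expKernel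
  split_ifs with h
  · have : (fun v : ℝ => Complex.exp (((2 * Real.pi * inner ℝ v x : ℝ) : ℂ) * Complex.I) •
        (Set.Ioi (0:ℝ)).indicator (fun y : ℝ => -(2 * Real.pi * Complex.I) *
      Complex.exp (-(2 * Real.pi * Complex.I) * a * y)) v) = (Set.Ioi (0:ℝ)).indicator
        (fun y : ℝ => -(2 * Real.pi * Complex.I) *
          Complex.exp (((2 * Real.pi * Complex.I) * (x - a)) * y)) := by
      ext y
      by_cases hy : y ∈ Set.Ioi (0:ℝ)
      · rw [Set.indicator_of_mem hy, Set.indicator_of_mem hy, smul_eq_mul, mul_left_comm,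
          ← Complex.exp_add]
        congr 2
        simp
        ring
      · rw [Set.indicator_of_notMem hy, Set.indicator_of_notMem hy]; simp
    rw [this, integral_indicator measurableSet_Ioi, integral_const_mul,
      integral_exp_mul_complex_Ioi]
    · simp
      field_simp
    · simp
      nlinarith [Real.pi_pos]
  · have : (fun v : ℝ => Complex.exp (((2 * Real.pi * inner ℝ v x : ℝ) : ℂ) * Complex.I) •
        (Set.Iic (0:ℝ)).indicator (fun y : ℝ => (2 * Real.pi * Complex.I) *
      Complex.exp (-(2 * Real.pi * Complex.I) * a * y)) v) = (Set.Iic (0:ℝ)).indicator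
        (fun y : ℝ => (2 * Real.pi * Complex.I) *
          Complex.exp (((2 * Real.pi * Complex.I) * (x - a)) * y)) := by
      ext y
      by_cases hy : y ∈ Set.Iic (0:ℝ)
      · rw [Set.indicator_of_mem hy, Set.indicator_of_mem hy, smul_eq_mul, mul_left_comm,
          ← Complex.exp_add]
        congr 2
        simp
        ring
      · rw [Set.indicator_of_notMem hy, Set.indicator_of_notMem hy]; simp
    rw [this, integral_indicator measurableSet_Iic, integral_const_mul,
      integral_exp_mul_complex_Iic]
    · rw [Complex.ofReal_zero, mul_zero, Complex.exp_zero]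
      field_simp
    · have : 0 < a.im := lt_of_le_of_ne (not_lt.1 h) ha.symm
      simp
      nlinarith [Real.pi_pos, mul_pos Real.pi_pos this]

theorem fourierInv_toLp_expKernel {a : ℂ} (ha : a.im ≠ 0) :
    (𝓕⁻ ((memLp_expKernel ha).toLp (expKernel a)) : L2R) =ᵐ[volume]
      fun x : ℝ => ((x : ℂ) - a)⁻¹ := by
  filter_upwards [fourierInv_toLp_ae_eq (integrable_expKernel ha) (memLp_expKernel ha)] with x hx
  rw [hx, fourierInv_expKernel ha]

/-- The function `x ↦ (x - a)⁻¹` as an element of `L²(ℝ)`, for non-real `a`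
(and `0` for real `a`). -/
def cauchy (a : ℂ) : L2R :=
  if ha : a.im ≠ 0 then 𝓕⁻ ((memLp_expKernel ha).toLp (expKernel a)) else 0

theorem cauchy_ae_eq {a : ℂ} (ha : a.im ≠ 0) :
    cauchy a =ᵐ[volume] fun x : ℝ => ((x : ℂ) - a)⁻¹ := by
  rw [cauchy, dif_pos ha]
  exact fourierInv_toLp_expKernel ha

theorem cauchy_mem_hardyPlus {a : ℂ} (ha : a.im < 0) : cauchy a ∈ hardyPlus := by
  rw [cauchy, dif_pos ha.ne]
  apply fourierInv_mem_hardyPlus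
  rw [mem_halfLine_iff]
  filter_upwards [(memLp_expKernel ha.ne).coeFn_toLp] with x hx h0
  rw [hx, expKernel, if_pos ha, Set.indicator_of_notMem (by simpa using h0)]

theorem cauchy_mem_orthogonal {a : ℂ} (ha : 0 < a.im) : cauchy a ∈ hardyPlusᗮ := by
  rw [cauchy, dif_pos ha.ne', Submodule.mem_orthogonal]
  intro u hu
  rw [mem_hardyPlus_iff, mem_halfLine_iff] at hu
  rw [← Lp.inner_fourier_eq, fourier_fourierInv_eq, L2.inner_def]
  apply integral_eq_zero_of_ae
  filter_upwards [hu, (memLp_expKernel ha.ne').coeFn_toLp] with x h1 h2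
  by_cases hx : x ≤ 0
  · rw [h1 hx]; simp
  · rw [h2, expKernel, if_neg ha.not_gt, Set.indicator_of_notMem (by simpa using hx)]; simp

/-- The Cauchy kernels on a horizontal line in the lower half-plane are total in `H₊`: on the
Fourier side, the integrals of `F ∈ L²(0, ∞)` against the exponentials `exp (2 π i s y - 2 π c y)`
are the Fourier integral of `exp (-2 π c y) F(y)`, which determines `F`. -/
theorem eq_zero_of_forall_inner_cauchy {c : ℝ} (hc : 0 < c) {f : L2R} (hf : f ∈ hardyPlus)
    (h : ∀ s : ℝ, inner ℂ (cauchy (s - c * Complex.I)) f = 0) : f = 0 := by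
  rw [mem_hardyPlus_iff, mem_halfLine_iff] at hf
  set F : L2R := 𝓕 f with hF
  set k : ℝ → ℂ := fun y => (starRingEnd ℂ) (expKernel (-(c * Complex.I)) y) with hk
  have hi : (-(c * Complex.I)).im ≠ 0 := by simpa using hc.ne'
  have hkL : MemLp k 2 := (memLp_expKernel hi).star
  have hkb : ∀ y, ‖k y‖ ≤ 2 * Real.pi := by
    intro y
    simp only [hk, RCLike.norm_conj, expKernel]
    rw [if_pos (by simpa using hc)]
    by_cases hy : y ∈ Set.Ioi (0:ℝ)
    · rw [Set.indicator_of_mem hy, norm_mul, Complex.norm_exp]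
      have : Real.exp (-(2 * Real.pi * Complex.I) * -(c * Complex.I) * (y:ℂ)).re ≤ 1 := by
        rw [Real.exp_le_one_iff]
        have : 0 < y := hy
        simp
        have := Real.pi_pos
        positivity
      have h2 : ‖(-(2 * Real.pi * Complex.I) : ℂ)‖ = 2 * Real.pi := by
        simp [abs_of_pos Real.pi_pos]
      rw [h2]
      have := Real.pi_pos
      exact mul_le_of_le_one_right (by positivity) ‹_›
    · rw [Set.indicator_of_notMem hy]; simp [Real.pi_pos.le]
  have h1 : Integrable (fun y => k y * F y) := by
    have := MemLp.integrable_mul hkL (Lp.memLp F)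
    exact this
  have h2 : MemLp (fun y => k y * F y) 2 := by
    refine MemLp.of_le_mul (c := 2 * Real.pi) (Lp.memLp F) h1.1 ?_
    filter_upwards with y
    rw [norm_mul]
    gcongr
    exact hkb y
  have h3 : (𝓕⁻ (h2.toLp _) : L2R) = 0 := by
    rw [Lp.eq_zero_iff_ae_eq_zero]
    filter_upwards [fourierInv_toLp_ae_eq h1 h2] with s hs
    rw [hs, Real.fourierInv_eq']
    have ha : ((s : ℂ) - c * Complex.I).im < 0 := by simpa using hc
    have := h s
    rw [cauchy, dif_pos ha.ne, ← Lp.inner_fourier_eq, fourier_fourierInv_eq, L2.inner_def] at this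
    rw [Pi.zero_apply, ← this]
    apply integral_congr_ae
    filter_upwards [(memLp_expKernel ha.ne).coeFn_toLp] with y hy
    rw [hy]
    simp only [hk, expKernel]
    rw [if_pos ha, if_pos (by simpa using hc)]
    by_cases hy : y ∈ Set.Ioi (0:ℝ)
    · rw [Set.indicator_of_mem hy, Set.indicator_of_mem hy]
      simp only [RCLike.inner_apply, smul_eq_mul, map_mul, ← Complex.exp_conj]
      rw [mul_comm _ (F y), mul_left_comm, mul_left_comm (Complex.exp _), ← Complex.exp_add]
      congr 3
      simp [Complex.conj_ofReal, Complex.conj_ofNat]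
      ring
    · rw [Set.indicator_of_notMem hy, Set.indicator_of_notMem hy]; simp
  have h4 : h2.toLp _ = 0 := by
    have := congrArg (fun g : L2R => (𝓕 g : L2R)) h3
    simp only [fourier_fourierInv_eq] at this
    rw [this]
    exact (Lp.fourierTransformₗᵢ ℝ ℂ).map_zero
  have h5 : F = 0 := by
    rw [Lp.eq_zero_iff_ae_eq_zero]
    have h4' := (Lp.eq_zero_iff_ae_eq_zero).1 h4
    filter_upwards [hf, h2.coeFn_toLp, h4'] with y hy hy2 hy3
    by_cases hy0 : y ≤ 0
    · exact hy hy0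
    · rw [hy3] at hy2
      have hk0 : k y ≠ 0 := by
        simp only [hk, expKernel]
        rw [if_pos (by simpa using hc), Set.indicator_of_mem (by simpa using hy0)]
        simp [Real.pi_ne_zero, Complex.exp_ne_zero]
      exact (mul_eq_zero.1 hy2.symm).resolve_left hk0
  rw [← norm_eq_zero, ← Lp.norm_fourier_eq, ← hF, h5, norm_zero]

end Fourier

open scoped BoundedContinuousFunction ComplexConjugate
open Filter Topology

/-! ### Multipliers and Toeplitz operators -/

theorem hardyPlus_le_of_cauchy_mem {c : ℝ} (hc : 0 < c) {p : Submodule ℂ L2R}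
    (hp : IsClosed (p : Set L2R)) (h : ∀ s : ℝ, cauchy (s - c * Complex.I) ∈ p) :
    hardyPlus ≤ p := by
  have hcl : IsClosed ((p ⊓ hardyPlus : Submodule ℂ L2R) : Set L2R) := by
    rw [Submodule.coe_inf]
    exact hp.inter isClosed_hardyPlus
  have : CompleteSpace (p ⊓ hardyPlus : Submodule ℂ L2R) := hcl.completeSpace_coe
  intro f hf
  set q := (p ⊓ hardyPlus : Submodule ℂ L2R).starProjection f with hq
  have hqm : q ∈ p ⊓ hardyPlus := Submodule.starProjection_apply_mem _ f
  have h0 : f - q = 0 := by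
    refine eq_zero_of_forall_inner_cauchy hc (Submodule.sub_mem _ hf hqm.2) fun s => ?_
    have : f - q ∈ (p ⊓ hardyPlus)ᗮ := Submodule.sub_starProjection_mem_orthogonal f
    refine (Submodule.mem_orthogonal _ _).1 this _ ⟨h s, cauchy_mem_hardyPlus (by simpa using hc)⟩
  rw [sub_eq_zero.1 h0]
  exact hqm.1

theorem memLp_bcf_mul (φ : ℝ →ᵇ ℂ) (f : L2R) : MemLp (fun x => φ x * f x) 2 := by
  refine MemLp.of_le_mul (c := ‖φ‖) (Lp.memLp f)
    (φ.continuous.aestronglyMeasurable.mul (Lp.memLp f).1) ?_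
  filter_upwards with x
  rw [norm_mul]
  gcongr
  exact φ.norm_coe_le_norm x

/-- Multiplication by a bounded continuous function, as a bounded operator in `L²(ℝ)`. -/
def mulL : (ℝ →ᵇ ℂ) →ₐ[ℂ] (L2R →L[ℂ] L2R) where
  toFun φ := LinearMap.mkContinuous
    { toFun := fun f => (memLp_bcf_mul φ f).toLp
      map_add' := by
        intro f g
        rw [← MemLp.toLp_add]
        apply MemLp.toLp_congr
        filter_upwards [Lp.coeFn_add f g] with x hx
        rw [hx, Pi.add_apply, mul_add]
        rfl
      map_smul' := by
        intro c f
        rw [RingHom.id_apply, ← MemLp.toLp_const_smul]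
        apply MemLp.toLp_congr
        filter_upwards [Lp.coeFn_smul c f] with x hx
        simp only [hx, Pi.smul_apply, smul_eq_mul]
        ring } ‖φ‖ (by
      intro f
      refine Lp.norm_le_mul_norm_of_ae_le_mul ?_
      filter_upwards [(memLp_bcf_mul φ f).coeFn_toLp] with x hx
      change ‖((memLp_bcf_mul φ f).toLp _ : L2R) x‖ ≤ _
      rw [hx, norm_mul]
      gcongr
      exact φ.norm_coe_le_norm x)
  map_one' := by
    ext f
    change (memLp_bcf_mul 1 f).toLp _ =ᵐ[volume] f
    filter_upwards [(memLp_bcf_mul 1 f).coeFn_toLp] with x hx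
    rw [hx]
    simp
  map_mul' := by
    intro φ ψ
    ext f
    change (memLp_bcf_mul (φ * ψ) f).toLp _ =ᵐ[volume]
      (memLp_bcf_mul φ ((memLp_bcf_mul ψ f).toLp _)).toLp _
    filter_upwards [(memLp_bcf_mul (φ * ψ) f).coeFn_toLp, (memLp_bcf_mul ψ f).coeFn_toLp,
      (memLp_bcf_mul φ ((memLp_bcf_mul ψ f).toLp _)).coeFn_toLp] with x h1 h2 h3
    rw [h1, h3, h2]
    simp [mul_assoc]
  map_zero' := by
    ext f
    change (memLp_bcf_mul 0 f).toLp _ =ᵐ[volume] (0 : L2R)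
    filter_upwards [(memLp_bcf_mul 0 f).coeFn_toLp, Lp.coeFn_zero ℂ 2 (volume : Measure ℝ)]
      with x hx h0
    rw [hx, h0]
    simp
  map_add' := by
    intro φ ψ
    ext f
    change (memLp_bcf_mul (φ + ψ) f).toLp _ =ᵐ[volume]
      ((memLp_bcf_mul φ f).toLp _ + (memLp_bcf_mul ψ f).toLp _ : L2R)
    filter_upwards [(memLp_bcf_mul (φ + ψ) f).coeFn_toLp, (memLp_bcf_mul ψ f).coeFn_toLp,
      (memLp_bcf_mul φ f).coeFn_toLp, Lp.coeFn_add ((memLp_bcf_mul φ f).toLp _ : L2R)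
        ((memLp_bcf_mul ψ f).toLp _)] with x h1 h2 h3 h4
    rw [h1, h4, Pi.add_apply, h2, h3]
    simp [add_mul]
  commutes' := by
    intro c
    ext f
    change (memLp_bcf_mul (algebraMap ℂ (ℝ →ᵇ ℂ) c) f).toLp _ =ᵐ[volume] (c • f : L2R)
    filter_upwards [(memLp_bcf_mul (algebraMap ℂ (ℝ →ᵇ ℂ) c) f).coeFn_toLp, Lp.coeFn_smul c f]
      with x hx h0
    rw [hx, h0]
    simp

theorem mulL_ae_eq (φ : ℝ →ᵇ ℂ) (f : L2R) : mulL φ f =ᵐ[volume] fun x => φ x * f x :=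
  (memLp_bcf_mul φ f).coeFn_toLp

theorem norm_mulL_le (φ : ℝ →ᵇ ℂ) (f : L2R) : ‖mulL φ f‖ ≤ ‖φ‖ * ‖f‖ := by
  refine Lp.norm_le_mul_norm_of_ae_le_mul ?_
  filter_upwards [mulL_ae_eq φ f] with x hx
  rw [hx, norm_mul]
  gcongr
  exact φ.norm_coe_le_norm x

theorem inner_mulL_left (φ : ℝ →ᵇ ℂ) (f g : L2R) :
    inner ℂ (mulL φ f) g = inner ℂ f (mulL (star φ) g) := by
  rw [L2.inner_def, L2.inner_def]
  apply integral_congr_ae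
  filter_upwards [mulL_ae_eq φ f, mulL_ae_eq (star φ) g] with x h1 h2
  rw [h1, h2]
  simp only [RCLike.inner_apply, map_mul, BoundedContinuousFunction.star_apply, RCLike.star_def]
  ring

theorem mulL_mul_apply (φ ψ : ℝ →ᵇ ℂ) (f : L2R) : mulL (φ * ψ) f = mulL φ (mulL ψ f) := by
  rw [map_mul]; rfl

/-- Strong convergence of multiplication operators, by dominated convergence. -/
theorem tendsto_mulL_zero {φ : ℕ → (ℝ →ᵇ ℂ)} {C : ℝ} (hC : ∀ n, ‖φ n‖ ≤ C)
    (h0 : ∀ᵐ x : ℝ, Tendsto (fun n => φ n x) atTop (𝓝 0)) (f : L2R) :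
    Tendsto (fun n => mulL (φ n) f) atTop (𝓝 0) := by
  rw [tendsto_zero_iff_norm_tendsto_zero]
  have key : Tendsto (fun n => ∫ x, ‖φ n x * f x‖ ^ 2) atTop (𝓝 (∫ _ : ℝ, (0:ℝ))) := by
    refine tendsto_integral_of_dominated_convergence (fun x => C ^ 2 * ‖f x‖ ^ 2) ?_ ?_ ?_ ?_
    · intro n
      exact ((memLp_bcf_mul (φ n) f).1.norm.pow 2)
    · exact ((memLp_two_iff_integrable_sq_norm (Lp.memLp f).1).1 (Lp.memLp f)).const_mul _
    · intro n
      filter_upwards with x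
      rw [Real.norm_of_nonneg (by positivity), norm_mul, mul_pow]
      gcongr
      exact ((φ n).norm_coe_le_norm x).trans (hC n)
    · filter_upwards [h0] with x hx
      simpa using ((hx.mul_const (f x)).norm.pow 2)
  have e : ∀ n, ‖mulL (φ n) f‖ = √(∫ x, ‖φ n x * f x‖ ^ 2) := by
    intro n
    rw [eq_comm, Real.sqrt_eq_iff_eq_sq (integral_nonneg fun _ => by positivity) (norm_nonneg _),
      ← inner_self_eq_norm_sq (𝕜 := ℂ), L2.inner_def, ← integral_re]
    · apply integral_congr_ae
      filter_upwards [mulL_ae_eq (φ n) f] with x hx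
      rw [inner_self_eq_norm_sq, hx]
    · exact L2.integrable_inner _ _
  simp only [e]
  have := (Real.continuous_sqrt.tendsto _).comp key
  simpa [Function.comp_def] using this

/-- The bounded continuous functions on `ℝ` that multiply `H₊` into itself. -/
def plusAlg : Subalgebra ℂ (ℝ →ᵇ ℂ) where
  carrier := {φ | ∀ h ∈ hardyPlus, mulL φ h ∈ hardyPlus}
  mul_mem' := by
    intro φ ψ hφ hψ h hh
    rw [mulL_mul_apply]
    exact hφ _ (hψ _ hh)
  add_mem' := by
    intro φ ψ hφ hψ h hh
    rw [map_add]
    exact hardyPlus.add_mem (hφ _ hh) (hψ _ hh)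
  algebraMap_mem' := by
    intro c h hh
    rw [AlgHom.commutes]
    exact hardyPlus.smul_mem c hh

theorem mulL_mem_orthogonal {φ : ℝ →ᵇ ℂ} (hφ : star φ ∈ plusAlg) {g : L2R}
    (hg : g ∈ hardyPlusᗮ) : mulL φ g ∈ hardyPlusᗮ := by
  rw [Submodule.mem_orthogonal] at hg ⊢
  intro u hu
  have := inner_mulL_left (star φ) u g
  rw [star_star] at this
  rw [← this]
  exact hg _ (hφ u hu)

/-- The Toeplitz (Wiener-Hopf) operator `h ↦ P (φ h)` in `H₊`. -/
def toep (φ : ℝ →ᵇ ℂ) : hardyPlus →L[ℂ] hardyPlus :=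
  hardyPlus.orthogonalProjectionOnto ∘L (mulL φ) ∘L hardyPlus.subtypeL

theorem toep_apply (φ : ℝ →ᵇ ℂ) (h : hardyPlus) :
    toep φ h = hardyPlus.orthogonalProjectionOnto (mulL φ h) := rfl

theorem coe_toep_of_mem {φ : ℝ →ᵇ ℂ} (hφ : φ ∈ plusAlg) (h : hardyPlus) :
    (toep φ h : L2R) = mulL φ h := by
  rw [toep_apply]
  exact Submodule.starProjection_eq_self_iff.2 (hφ _ h.2)

theorem toep_one : toep 1 = 1 := by
  ext1 h
  apply Subtype.ext
  rw [coe_toep_of_mem (one_mem _)]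
  simp

theorem toep_mul_of_mem_right (φ : ℝ →ᵇ ℂ) {ψ : ℝ →ᵇ ℂ} (hψ : ψ ∈ plusAlg) :
    toep (φ * ψ) = toep φ * toep ψ := by
  ext1 h
  rw [toep_apply, mulL_mul_apply, mul_apply_eq_comp, toep_apply φ, coe_toep_of_mem hψ]

theorem toep_mul_of_star_mem_left {φ : ℝ →ᵇ ℂ} (hφ : star φ ∈ plusAlg) (ψ : ℝ →ᵇ ℂ) :
    toep (φ * ψ) = toep φ * toep ψ := by
  ext1 h
  rw [toep_apply, mulL_mul_apply, mul_apply_eq_comp, toep_apply φ, ← sub_eq_zero,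
    ← map_sub, ← map_sub, Submodule.orthogonalProjectionOnto_eq_zero_iff]
  apply mulL_mem_orthogonal hφ
  exact Submodule.sub_starProjection_mem_orthogonal _

theorem toep_pow_of_star_mem {φ : ℝ →ᵇ ℂ} (hφ : star φ ∈ plusAlg) (n : ℕ) :
    toep (φ ^ n) = toep φ ^ n := by
  induction n with
  | zero => rw [pow_zero, pow_zero, toep_one]
  | succ n ih => rw [pow_succ', pow_succ', toep_mul_of_star_mem_left hφ, ih]

theorem toep_pow_of_mem {φ : ℝ →ᵇ ℂ} (hφ : φ ∈ plusAlg) (n : ℕ) :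
    toep (φ ^ n) = toep φ ^ n := by
  induction n with
  | zero => rw [pow_zero, pow_zero, toep_one]
  | succ n ih => rw [pow_succ, pow_succ, toep_mul_of_mem_right _ hφ, ih]

theorem norm_inv_ofReal_sub_le {a : ℂ} (ha : a.im ≠ 0) (x : ℝ) :
    ‖((x : ℂ) - a)⁻¹‖ ≤ |a.im|⁻¹ := by
  rw [norm_inv]
  have : 0 < |a.im| := abs_pos.2 ha
  gcongr
  simpa using Complex.abs_im_le_norm ((x : ℂ) - a)

/-- The function `x ↦ (x - a)⁻¹` as a bounded continuous function, for non-real `a`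
(and `0` for real `a`). -/
def res (a : ℂ) : ℝ →ᵇ ℂ :=
  if ha : a.im ≠ 0 then
    BoundedContinuousFunction.ofNormedAddCommGroup (fun x : ℝ => ((x : ℂ) - a)⁻¹)
      ((by fun_prop : Continuous fun x : ℝ => (x : ℂ) - a).inv₀ (ofReal_sub_ne_zero ha))
      |a.im|⁻¹ (norm_inv_ofReal_sub_le ha)
  else 0

/-- The function `x ↦ (x - b) / (x - a)` as a bounded continuous function, for non-real `a`. -/
def fac (b a : ℂ) : ℝ →ᵇ ℂ := 1 + (a - b) • res a

theorem res_apply {a : ℂ} (ha : a.im ≠ 0) (x : ℝ) : res a x = ((x : ℂ) - a)⁻¹ := by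
  rw [res, dif_pos ha]; rfl

theorem fac_apply (b : ℂ) {a : ℂ} (ha : a.im ≠ 0) (x : ℝ) :
    fac b a x = ((x : ℂ) - b) / ((x : ℂ) - a) := by
  have := ofReal_sub_ne_zero ha x
  simp only [fac, BoundedContinuousFunction.coe_add, BoundedContinuousFunction.coe_one,
    BoundedContinuousFunction.coe_smul, Pi.add_apply, Pi.one_apply, res_apply ha, smul_eq_mul]
  field_simp
  ring

theorem norm_res_le {a : ℂ} (ha : a.im ≠ 0) : ‖res a‖ ≤ |a.im|⁻¹ := by
  rw [BoundedContinuousFunction.norm_le (by positivity)]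
  intro x
  rw [res_apply ha]
  exact norm_inv_ofReal_sub_le ha x

/-- For real `t`, the factor `(x - t) / (x - a)` with `a` on the vertical line through `t` has
modulus at most one. -/
theorem norm_fac_le_one {a : ℂ} (ha : a.im ≠ 0) : ‖fac (a.re : ℂ) a‖ ≤ 1 := by
  rw [BoundedContinuousFunction.norm_le zero_le_one]
  intro x
  rw [fac_apply _ ha, norm_div]
  refine div_le_one_of_le₀ ?_ (norm_nonneg _)
  rw [← Complex.ofReal_sub, Complex.norm_real]
  simpa using Complex.abs_re_le_norm ((x : ℂ) - a)

theorem star_res (a : ℂ) : star (res a) = res (conj a) := by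
  by_cases ha : a.im ≠ 0
  · ext x
    rw [BoundedContinuousFunction.star_apply, res_apply ha, res_apply (by simpa using ha)]
    simp
  · rw [res, dif_neg ha, res, dif_neg (by simpa using ha), star_zero]

theorem star_fac (b a : ℂ) : star (fac b a) = fac (conj b) (conj a) := by
  rw [fac, star_add, star_one, star_smul, star_res, fac]
  simp

theorem mulL_res_cauchy {a b : ℂ} (ha : a.im ≠ 0) (hb : b.im ≠ 0) (hab : a ≠ b) :
    mulL (res a) (cauchy b) = (a - b)⁻¹ • (cauchy a - cauchy b) := by
  ext1
  filter_upwards [mulL_ae_eq (res a) (cauchy b), cauchy_ae_eq ha, cauchy_ae_eq hb,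
    Lp.coeFn_smul (a - b)⁻¹ (cauchy a - cauchy b), Lp.coeFn_sub (cauchy a) (cauchy b)]
    with x h1 h2 h3 h4 h5
  rw [h1, h4, Pi.smul_apply, h5, Pi.sub_apply, h2, h3, res_apply ha, smul_eq_mul]
  have := ofReal_sub_ne_zero ha x
  have := ofReal_sub_ne_zero hb x
  have := sub_ne_zero.2 hab
  field_simp
  ring

theorem mulL_fac_cauchy (b : ℂ) {a : ℂ} (ha : a.im ≠ 0) (hb : b.im ≠ 0) :
    mulL (fac b a) (cauchy b) = cauchy a := by
  ext1
  filter_upwards [mulL_ae_eq (fac b a) (cauchy b), cauchy_ae_eq ha, cauchy_ae_eq hb]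
    with x h1 h2 h3
  rw [h1, h2, h3, fac_apply b ha]
  have := ofReal_sub_ne_zero ha x
  have := ofReal_sub_ne_zero hb x
  field_simp

/-- By partial fractions, `(x - a)⁻¹` multiplies Cauchy kernels into combinations of Cauchy kernels,
and these are total in `H₊`. -/
theorem res_mem_plusAlg {a : ℂ} (ha : a.im < 0) : res a ∈ plusAlg := by
  obtain ⟨c, hc, hca⟩ : ∃ c : ℝ, 0 < c ∧ a.im ≠ -c :=
    ⟨1 - a.im, by linarith, by intro h; linarith⟩
  refine hardyPlus_le_of_cauchy_mem hc
    (p := hardyPlus.comap (mulL (res a)).toLinearMap)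
    (isClosed_hardyPlus.preimage (mulL (res a)).continuous) fun s => ?_
  have hs : ((s : ℂ) - c * Complex.I).im < 0 := by simpa using hc
  have hne : a ≠ s - c * Complex.I := by
    intro h
    apply hca
    rw [h]; simp
  change mulL (res a) (cauchy (s - c * Complex.I)) ∈ hardyPlus
  rw [mulL_res_cauchy ha.ne hs.ne hne]
  exact hardyPlus.smul_mem _ (hardyPlus.sub_mem (cauchy_mem_hardyPlus ha) (cauchy_mem_hardyPlus hs))

theorem fac_mem_plusAlg (b : ℂ) {a : ℂ} (ha : a.im < 0) : fac b a ∈ plusAlg :=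
  add_mem (one_mem _) (Subalgebra.smul_mem _ (res_mem_plusAlg ha) _)

theorem star_res_mem_plusAlg {a : ℂ} (ha : 0 < a.im) : star (res a) ∈ plusAlg := by
  rw [star_res]
  exact res_mem_plusAlg (by simpa using ha)

theorem star_fac_mem_plusAlg (b : ℂ) {a : ℂ} (ha : 0 < a.im) : star (fac b a) ∈ plusAlg := by
  rw [star_fac]
  exact fac_mem_plusAlg _ (by simpa using ha)

theorem fac_mul_fac {a b : ℂ} (c : ℂ) (ha : a.im ≠ 0) (hb : b.im ≠ 0) :
    fac b a * fac c b = fac c a := by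
  ext x
  rw [BoundedContinuousFunction.mul_apply, fac_apply _ ha, fac_apply _ hb, fac_apply _ ha]
  have := ofReal_sub_ne_zero ha x
  have := ofReal_sub_ne_zero hb x
  field_simp

theorem fac_self {a : ℂ} : fac a a = 1 := by simp [fac]

theorem fac_mul_res {a b : ℂ} (ha : a.im ≠ 0) (hb : b.im ≠ 0) :
    fac b a * res b = res a := by
  ext x
  rw [BoundedContinuousFunction.mul_apply, fac_apply _ ha, res_apply hb, res_apply ha]
  have := ofReal_sub_ne_zero ha x
  have := ofReal_sub_ne_zero hb x
  field_simp

theorem norm_cauchy_sq {a : ℂ} (ha : a.im < 0) : ‖cauchy a‖ ^ 2 = Real.pi / (-a.im) := by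
  rw [← Lp.norm_fourier_eq, cauchy, dif_pos ha.ne, FourierTransform.fourier_fourierInv_eq,
    ← inner_self_eq_norm_sq (𝕜 := ℂ), L2.inner_def, ← integral_re (L2.integrable_inner _ _)]
  have e : (∫ y, (Set.Ioi (0:ℝ)).indicator
      (fun y : ℝ => (2 * Real.pi) ^ 2 * Real.exp ((4 * Real.pi * a.im) * y)) y)
      = Real.pi / (-a.im) := by
    rw [integral_indicator measurableSet_Ioi, integral_const_mul, integral_exp_mul_Ioi]
    · have := Real.pi_ne_zero
      have := ha.ne
      simp
      field_simp
      ring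
    · nlinarith [Real.pi_pos]
  rw [← e]
  apply integral_congr_ae
  filter_upwards [(memLp_expKernel ha.ne).coeFn_toLp] with y hy
  rw [hy, inner_self_eq_norm_sq, expKernel, if_pos ha]
  by_cases hy : y ∈ Set.Ioi (0:ℝ)
  · rw [Set.indicator_of_mem hy, Set.indicator_of_mem hy, norm_mul, mul_pow, Complex.norm_exp,
      ← Real.exp_nat_mul]
    simp [abs_of_pos Real.pi_pos]
    ring_nf
  · rw [Set.indicator_of_notMem hy, Set.indicator_of_notMem hy]; simp

theorem cauchy_ne_zero {a : ℂ} (ha : a.im < 0) : cauchy a ≠ 0 := by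
  intro h
  have := norm_cauchy_sq ha
  rw [h] at this
  have h2 : 0 < Real.pi / (-a.im) := div_pos Real.pi_pos (by linarith)
  simp at this
  simp [← this] at h2

/-! ### The Blaschke factor and outer functions -/

section OneSidedInverse

variable {H : Type*} [NormedAddCommGroup H] [NormedSpace ℂ H]

theorem pow_mul_pow_of_mul_eq_one {V W : H →L[ℂ] H} (hVW : V * W = 1) (k : ℕ) :
    V ^ k * W ^ k = 1 := by
  induction k with
  | zero => simp
  | succ k ih => rw [pow_succ, pow_succ', mul_assoc, ← mul_assoc V, hVW, one_mul, ih]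

theorem isCompl_range_ker_of_mul_eq_one {V W : H →L[ℂ] H} (hVW : V * W = 1) :
    IsCompl W.range V.ker := by
  have hv : ∀ x, V (W x) = x := fun x => congrArg (fun A : H →L[ℂ] H => A x) hVW
  constructor
  · rw [Submodule.disjoint_def]
    rintro _ ⟨y, rfl⟩ hy
    have h0 : V (W y) = 0 := hy
    rw [hv] at h0
    simp [h0]
  · rw [codisjoint_iff, eq_top_iff]
    intro x _
    rw [Submodule.mem_sup]
    refine ⟨W (V x), ⟨V x, rfl⟩, x - W (V x), ?_, by abel⟩
    change V (x - W (V x)) = 0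
    rw [map_sub, hv, sub_self]

/-- If `V` has a right inverse and a one-dimensional kernel, then the kernel of `V ^ k` has
dimension `k`. -/
theorem finrank_ker_pow {V W : H →L[ℂ] H} (hVW : V * W = 1) {e : H} (he : e ≠ 0) (hVe : V e = 0)
    (hker : ∀ h, ∃ c : ℂ, h = W (V h) + c • e) (k : ℕ) :
    FiniteDimensional ℂ (V ^ k).ker ∧ Module.finrank ℂ (V ^ k).ker = k := by
  have hv : ∀ x, V (W x) = x := fun x => congrArg (fun A : H →L[ℂ] H => A x) hVW
  induction k with
  | zero =>
    have : (V ^ 0).ker = ⊥ := by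
      rw [pow_zero, Submodule.eq_bot_iff]
      intro x hx
      exact hx
    rw [this]
    exact ⟨inferInstance, finrank_bot ℂ H⟩
  | succ k ih =>
    obtain ⟨hfd, hfr⟩ := ih
    let A : ((V ^ k).ker × ℂ) →ₗ[ℂ] H :=
      (W.toLinearMap ∘ₗ (V ^ k).ker.subtype).coprod (LinearMap.toSpanSingleton ℂ H e)
    have hA : ∀ g c, A (g, c) = W g + c • e := fun g c => by simp [A]
    have hinj : Function.Injective A := by
      rw [← LinearMap.ker_eq_bot, LinearMap.ker_eq_bot']
      rintro ⟨g, c⟩ h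
      rw [hA] at h
      have h1 : (g : H) = 0 := by
        have := congrArg V h
        rwa [map_add, map_smul, hVe, smul_zero, add_zero, hv, map_zero] at this
      rw [h1, map_zero, zero_add, smul_eq_zero] at h
      ext
      · exact h1
      · exact h.resolve_right he
    have hrange : LinearMap.range A = (V ^ (k + 1)).ker := by
      ext x
      constructor
      · rintro ⟨⟨g, c⟩, rfl⟩
        rw [hA]
        change (V ^ (k + 1)) (W g + c • e) = 0
        rw [pow_succ, mul_apply_eq_comp, map_add, map_smul, hVe, hv, smul_zero,
          add_zero]
        exact g.2
      · intro hx
        obtain ⟨c, hc⟩ := hker x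
        refine ⟨(⟨V x, ?_⟩, c), ?_⟩
        · change (V ^ (k + 1)) x = 0 at hx
          rwa [pow_succ, mul_apply_eq_comp] at hx
        · rw [hA, ← hc]
    let E := (LinearEquiv.ofInjective A hinj).trans (LinearEquiv.ofEq _ _ hrange)
    refine ⟨Module.Finite.equiv E, ?_⟩
    rw [← E.finrank_eq, Module.finrank_prod, hfr, Module.finrank_self]

end OneSidedInverse

/-- Multiplication by the Blaschke factor `(x - i) / (x + i)` in `H₊`. -/
def blaschkeOp : hardyPlus →L[ℂ] hardyPlus := toep (fac Complex.I (-Complex.I))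

/-- The Toeplitz operator with symbol `(x + i) / (x - i)`, the adjoint of `blaschkeOp`. -/
def coBlaschkeOp : hardyPlus →L[ℂ] hardyPlus := toep (fac (-Complex.I) Complex.I)

/-- The Cauchy kernel `1 / (x + i)` as an element of `H₊`. -/
def kerVec : hardyPlus := ⟨cauchy (-Complex.I), cauchy_mem_hardyPlus (by simp)⟩

theorem kerVec_ne_zero : kerVec ≠ 0 := by
  intro h
  exact cauchy_ne_zero (a := -Complex.I) (by simp) (congrArg Subtype.val h)

theorem coBlaschkeOp_mul_blaschkeOp : coBlaschkeOp * blaschkeOp = 1 := by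
  rw [coBlaschkeOp, blaschkeOp, ← toep_mul_of_mem_right _ (fac_mem_plusAlg _ (by simp)),
    fac_mul_fac _ (by simp) (by simp), fac_self, toep_one]

theorem coBlaschkeOp_kerVec : coBlaschkeOp kerVec = 0 := by
  rw [coBlaschkeOp, toep_apply, kerVec, mulL_fac_cauchy _ (by simp) (by simp),
    Submodule.orthogonalProjectionOnto_eq_zero_iff]
  exact cauchy_mem_orthogonal (by simp)

theorem exists_eq_blaschkeOp_add (h : hardyPlus) :
    ∃ c : ℂ, h = blaschkeOp (coBlaschkeOp h) + c • kerVec := by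
  set Z : L2R →L[ℂ] L2R := 1 - mulL (fac Complex.I (-Complex.I)) ∘L
    hardyPlus.starProjection ∘L mulL (fac (-Complex.I) Complex.I) with hZ
  have hle : hardyPlus ≤ (ℂ ∙ cauchy (-Complex.I)).comap Z.toLinearMap := by
    refine hardyPlus_le_of_cauchy_mem two_pos
      ((Submodule.closed_of_finiteDimensional (ℂ ∙ cauchy (-Complex.I))).preimage Z.continuous)
      fun s => ?_
    set b : ℂ := s - (2 : ℝ) * Complex.I with hb
    have hbim : b.im = -2 := by simp [hb]
    have hb0 : b.im < 0 := by rw [hbim]; norm_num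
    have h1 : Complex.I ≠ b := by
      intro h; rw [← h] at hbim; simp at hbim; norm_num at hbim
    have h2 : -Complex.I ≠ b := by
      intro h; rw [← h] at hbim; simp at hbim
    have h1' : Complex.I - b ≠ 0 := sub_ne_zero.2 h1
    have h2' : -Complex.I - b ≠ 0 := sub_ne_zero.2 h2
    have e1 : hardyPlus.starProjection (mulL (fac (-Complex.I) Complex.I) (cauchy b)) =
        ((-Complex.I - b) / (Complex.I - b)) • cauchy b := by
      have : mulL (fac (-Complex.I) Complex.I) (cauchy b) =
          ((-Complex.I - b) / (Complex.I - b)) • cauchy b +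
            (2 * Complex.I / (Complex.I - b)) • cauchy Complex.I := by
        rw [fac, map_add, map_one, map_smul, _root_.add_apply,
          _root_.smul_apply, mulL_res_cauchy (by simp) hb0.ne h1,
          one_apply_eq_self]
        match_scalars <;> field_simp <;> ring
      rw [this, map_add, map_smul, map_smul,
        Submodule.starProjection_eq_self_iff.2 (cauchy_mem_hardyPlus hb0),
        (Submodule.starProjection_apply_eq_zero_iff _).2 (cauchy_mem_orthogonal (by simp)),
        smul_zero, add_zero]
    have e2 : mulL (fac Complex.I (-Complex.I)) (cauchy b) =
          ((Complex.I - b) / (-Complex.I - b)) • cauchy b +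
            (-2 * Complex.I / (-Complex.I - b)) • cauchy (-Complex.I) := by
        rw [fac, map_add, map_one, map_smul, _root_.add_apply,
          _root_.smul_apply, mulL_res_cauchy (by simp) hb0.ne h2,
          one_apply_eq_self]
        match_scalars <;> field_simp <;> ring
    have e3 : Z (cauchy b) = (2 * Complex.I / (Complex.I - b)) • cauchy (-Complex.I) := by
      simp only [hZ, _root_.sub_apply, one_apply_eq_self,
        ContinuousLinearMap.comp_apply]
      rw [e1, map_smul, e2]
      match_scalars <;> field_simp
      ring
    change Z (cauchy b) ∈ (ℂ ∙ cauchy (-Complex.I))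
    rw [e3]
    exact Submodule.smul_mem _ _ (Submodule.mem_span_singleton_self _)
  obtain ⟨c, hc⟩ := Submodule.mem_span_singleton.1 (hle h.2)
  refine ⟨c, ?_⟩
  apply Subtype.ext
  rw [Submodule.coe_add, Submodule.coe_smul, blaschkeOp,
    coe_toep_of_mem (fac_mem_plusAlg _ (by simp))]
  change (h : L2R) = mulL (fac Complex.I (-Complex.I)) (hardyPlus.starProjection
    (mulL (fac (-Complex.I) Complex.I) h)) + c • cauchy (-Complex.I)
  rw [hc]
  simp [hZ]

theorem finrank_ker_coBlaschkeOp_pow (k : ℕ) :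
    FiniteDimensional ℂ (coBlaschkeOp ^ k).ker ∧ Module.finrank ℂ (coBlaschkeOp ^ k).ker = k :=
  finrank_ker_pow coBlaschkeOp_mul_blaschkeOp kerVec_ne_zero coBlaschkeOp_kerVec
    exists_eq_blaschkeOp_add k

/-- The kernel of the `k`-th power of `coBlaschkeOp` consists of the functions `p / (x + i) ^ k`
with polynomials `p` of degree less than `k`. -/
theorem exists_polynomial_of_coBlaschkeOp_pow_eq_zero (k : ℕ) {f : hardyPlus}
    (hf : (coBlaschkeOp ^ k) f = 0) :
    ∃ p : ℂ[X], p.degree < k ∧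
      ∀ᵐ x : ℝ, ((x : ℂ) + Complex.I) ^ k * (f : L2R) x = p.eval (x : ℂ) := by
  induction k generalizing f with
  | zero =>
    refine ⟨0, by simp, ?_⟩
    have : f = 0 := hf
    rw [this]
    filter_upwards [Lp.coeFn_zero ℂ 2 (volume : Measure ℝ)] with x hx
    rw [Submodule.coe_zero, hx]
    simp
  | succ k ih =>
    rw [pow_succ, mul_apply_eq_comp] at hf
    obtain ⟨p, hp, hpe⟩ := ih hf
    obtain ⟨c, hc⟩ := exists_eq_blaschkeOp_add f
    refine ⟨(X - C Complex.I) * p + C c * (X + C Complex.I) ^ k, ?_, ?_⟩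
    · have hk : (k : WithBot ℕ) < ((k + 1 : ℕ) : WithBot ℕ) := by
        exact_mod_cast Nat.lt_succ_self k
      refine (degree_add_le _ _).trans_lt (max_lt ?_ ?_)
      · rw [degree_mul, degree_X_sub_C]
        by_cases hp0 : p = 0
        · rw [hp0]; simp
        · rw [degree_eq_natDegree hp0] at hp ⊢
          have : p.natDegree < k := by exact_mod_cast hp
          have h2 : 1 + p.natDegree < k + 1 := by omega
          exact_mod_cast h2
      · rw [← smul_eq_C_mul]
        refine (degree_smul_le _ _).trans_lt ?_
        rw [degree_pow, degree_X_add_C]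
        simpa using hk
    · have hf' : (f : L2R) = mulL (fac Complex.I (-Complex.I)) (coBlaschkeOp f : hardyPlus) +
          c • cauchy (-Complex.I) := by
        conv_lhs => rw [hc]
        rw [Submodule.coe_add, Submodule.coe_smul, blaschkeOp,
          coe_toep_of_mem (fac_mem_plusAlg _ (by simp))]
        rfl
      filter_upwards [hpe, mulL_ae_eq (fac Complex.I (-Complex.I)) (coBlaschkeOp f : hardyPlus),
        Lp.coeFn_add (mulL (fac Complex.I (-Complex.I)) (coBlaschkeOp f : hardyPlus))
          (c • cauchy (-Complex.I)), Lp.coeFn_smul c (cauchy (-Complex.I)),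
        cauchy_ae_eq (a := -Complex.I) (by simp)] with x h1 h2 h3 h4 h5
      rw [hf', h3, Pi.add_apply, h4, Pi.smul_apply, h5, h2, fac_apply _ (by simp)]
      simp only [eval_add, eval_mul, eval_sub, eval_X, eval_C, eval_pow, ← h1, smul_eq_mul]
      have : (x : ℂ) + Complex.I ≠ 0 := by
        simpa using ofReal_sub_ne_zero (a := -Complex.I) (by simp) x
      rw [sub_neg_eq_add]
      field_simp
      ring

/-- The properties of outer functions that are used below: `φ` multiplies `H₊` injectively into
itself with dense range, and division by `φ` does not lead out of `H₊` within `L²(ℝ)`. -/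
structure IsOuter (φ : ℝ →ᵇ ℂ) : Prop where
  mem : φ ∈ plusAlg
  inj : ∀ u : L2R, mulL φ u = 0 → u = 0
  of_mul_mem : ∀ u : L2R, mulL φ u ∈ hardyPlus → u ∈ hardyPlus
  dense : DenseRange (toep φ)

theorem IsOuter.one : IsOuter 1 where
  mem := one_mem _
  inj u hu := by simpa using hu
  of_mul_mem u hu := by simpa using hu
  dense := by
    rw [toep_one]
    exact Function.surjective_id.denseRange

theorem IsOuter.mul {φ ψ : ℝ →ᵇ ℂ} (hφ : IsOuter φ) (hψ : IsOuter ψ) : IsOuter (φ * ψ) where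
  mem := mul_mem hφ.mem hψ.mem
  inj u hu := hψ.inj _ (hφ.inj _ (by rwa [← mulL_mul_apply]))
  of_mul_mem u hu := hψ.of_mul_mem _ (hφ.of_mul_mem _ (by rwa [← mulL_mul_apply]))
  dense := by
    rw [toep_mul_of_mem_right _ hψ.mem]
    exact hφ.dense.comp hψ.dense (toep φ).continuous

theorem IsOuter.pow {φ : ℝ →ᵇ ℂ} (hφ : IsOuter φ) (n : ℕ) : IsOuter (φ ^ n) := by
  induction n with
  | zero => rw [pow_zero]; exact .one
  | succ n ih => rw [pow_succ]; exact ih.mul hφ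

theorem IsOuter.multiset_prod {s : Multiset (ℝ →ᵇ ℂ)} (hs : ∀ φ ∈ s, IsOuter φ) :
    IsOuter s.prod := by
  induction s using Multiset.induction with
  | empty => rw [Multiset.prod_zero]; exact .one
  | cons a s ih =>
    rw [Multiset.prod_cons]
    exact (hs a (Multiset.mem_cons_self _ _)).mul
      (ih fun φ h => hs φ (Multiset.mem_cons_of_mem h))

/-- If the multipliers `χ n` of `H₊` satisfy `χ n * φ → 1` boundedly and almost everywhere, then `φ`
is outer: `u` is the limit of the functions `χ n * (φ u) = φ * (χ n u)`. -/
theorem IsOuter.of_approx {φ : ℝ →ᵇ ℂ} (hφ : φ ∈ plusAlg) {χ : ℕ → (ℝ →ᵇ ℂ)}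
    (hχ : ∀ n, χ n ∈ plusAlg) {C : ℝ} (hC : ∀ n, ‖1 - χ n * φ‖ ≤ C)
    (h0 : ∀ᵐ x : ℝ, Tendsto (fun n => (1 - χ n * φ) x) atTop (𝓝 0)) : IsOuter φ := by
  have key : ∀ u : L2R, Tendsto (fun n => mulL (χ n) (mulL φ u)) atTop (𝓝 u) := by
    intro u
    have := (tendsto_const_nhds (x := u)).sub (tendsto_mulL_zero hC h0 u)
    rw [sub_zero] at this
    refine this.congr fun n => ?_
    rw [map_sub, map_one, ← mulL_mul_apply]
    simp
  refine ⟨hφ, fun u hu => ?_, fun u hu => ?_, fun u => ?_⟩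
  · have := key u
    simp only [hu, map_zero] at this
    exact tendsto_nhds_unique this tendsto_const_nhds
  · exact isClosed_hardyPlus.mem_of_tendsto (key u) (Eventually.of_forall fun n => hχ n _ hu)
  · refine mem_closure_of_tendsto (f := fun n => toep φ (toep (χ n) u)) (b := atTop) ?_
      (Eventually.of_forall fun n => ⟨_, rfl⟩)
    rw [tendsto_subtype_rng]
    refine (key u).congr fun n => ?_
    rw [coe_toep_of_mem hφ, coe_toep_of_mem (hχ n), ← mulL_mul_apply, ← mulL_mul_apply, mul_comm]

theorem isOuter_fac {a : ℂ} (ha : a.im = 0) : IsOuter (fac a (-Complex.I)) := by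
  have hI : (-Complex.I).im ≠ 0 := by simp
  set ε : ℕ → ℝ := fun n => 1 / ((n : ℝ) + 1) with hε
  have hpos : ∀ n, 0 < ε n := fun n => by positivity
  set b : ℕ → ℂ := fun n => a - ε n * Complex.I with hb
  have him : ∀ n, (b n).im = -ε n := fun n => by simp [hb, ha]
  have hneg : ∀ n, (b n).im < 0 := fun n => by rw [him]; exact neg_neg_of_pos (hpos n)
  have e : ∀ n, 1 - fac (-Complex.I) (b n) * fac a (-Complex.I) =
      (ε n * Complex.I) • res (b n) := by
    intro n
    rw [fac_mul_fac _ (hneg n).ne hI, fac, sub_add_cancel_left, ← neg_smul]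
    congr 1
    simp [hb]
  refine IsOuter.of_approx (χ := fun n => fac (-Complex.I) (b n)) (C := 1)
    (fac_mem_plusAlg _ (by simp)) (fun n => fac_mem_plusAlg _ (hneg n)) (fun n => ?_) ?_
  · rw [e, norm_smul]
    have h1 := norm_res_le (hneg n).ne
    rw [him, abs_neg, abs_of_pos (hpos n)] at h1
    have h2 : ‖(ε n : ℂ) * Complex.I‖ = ε n := by simp [abs_of_pos (hpos n)]
    rw [h2]
    calc ε n * ‖res (b n)‖ ≤ ε n * (ε n)⁻¹ := by gcongr
      _ = 1 := mul_inv_cancel₀ (hpos n).ne'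
  · have hne : ∀ᵐ x : ℝ, x ≠ a.re := by
      simp [ae_iff, measure_singleton]
    filter_upwards [hne] with x hx
    have hε0 : Tendsto (fun n => ((ε n : ℝ) : ℂ)) atTop (𝓝 0) := by
      have := (Complex.continuous_ofReal.tendsto 0).comp
        (tendsto_one_div_add_atTop_nhds_zero_nat (𝕜 := ℝ))
      simpa [Function.comp_def, hε] using this
    have hxa : (x : ℂ) - a ≠ 0 := by
      intro h
      apply hx
      have := congrArg Complex.re h
      simpa [sub_eq_zero] using this
    have hlim : Tendsto (fun n => (ε n * Complex.I) * ((x : ℂ) - b n)⁻¹) atTop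
        (𝓝 ((0 * Complex.I) * ((x : ℂ) - (a - 0 * Complex.I))⁻¹)) := by
      refine (hε0.mul_const _).mul (Tendsto.inv₀ ?_ (by simpa using hxa))
      exact tendsto_const_nhds.sub (tendsto_const_nhds.sub (hε0.mul_const _))
    simp only [zero_mul] at hlim
    refine hlim.congr fun n => ?_
    rw [e]
    simp [res_apply (hneg n).ne]

theorem isOuter_res : IsOuter (res (-Complex.I)) := by
  have hI : (-Complex.I).im ≠ 0 := by simp
  set N : ℕ → ℝ := fun n => (n : ℝ) + 1 with hN
  have hpos : ∀ n, 0 < N n := fun n => by positivity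
  set b : ℕ → ℂ := fun n => -(N n * Complex.I) with hb
  have him : ∀ n, (b n).im = -N n := fun n => by simp [hb]
  have hneg : ∀ n, (b n).im < 0 := fun n => by rw [him]; exact neg_neg_of_pos (hpos n)
  have e : ∀ n, 1 - (-b n) • fac (-Complex.I) (b n) * res (-Complex.I) = fac 0 (b n) := by
    intro n
    rw [smul_mul_assoc, fac_mul_res (hneg n).ne hI, fac]
    simp
  refine IsOuter.of_approx (χ := fun n => (-b n) • fac (-Complex.I) (b n)) (C := 1)
    (res_mem_plusAlg (by simp))
    (fun n => Subalgebra.smul_mem _ (fac_mem_plusAlg _ (hneg n)) _) (fun n => ?_) ?_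
  · rw [e]
    have := norm_fac_le_one (hneg n).ne
    simpa [hb] using this
  · filter_upwards with x
    have hlim : Tendsto (fun n => ‖(x : ℂ)‖ * (N n)⁻¹) atTop (𝓝 (‖(x : ℂ)‖ * 0)) := by
      refine tendsto_const_nhds.mul (tendsto_inv_atTop_zero.comp ?_)
      exact tendsto_atTop_add_const_right _ _ tendsto_natCast_atTop_atTop
    rw [mul_zero] at hlim
    refine squeeze_zero_norm (fun n => ?_) hlim
    rw [e, fac_apply _ (hneg n).ne, sub_zero, div_eq_mul_inv, norm_mul]
    gcongr
    have := norm_inv_ofReal_sub_le (hneg n).ne x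
    rwa [him, abs_neg, abs_of_pos (hpos n)] at this

theorem IsOuter.toep_injective {φ : ℝ →ᵇ ℂ} (hφ : IsOuter φ) : Function.Injective (toep φ) := by
  rw [injective_iff_map_eq_zero]
  intro u hu
  have := coe_toep_of_mem hφ.mem u
  rw [hu] at this
  exact Subtype.ext (hφ.inj _ this.symm)

/-- Multiplication by `(x - a) / (x + i)` with real `a` is not bounded below on `H₊`: it maps the
functions `1 / (x - a + i ε)`, of norm `(π / ε) ^ (1/2)`, into a bounded set. -/
theorem not_bounded_below_fac {a : ℂ} (ha : a.im = 0) (K : ℝ) :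
    ¬ ∀ u : hardyPlus, ‖u‖ ≤ K * ‖toep (fac a (-Complex.I)) u‖ := by
  intro h
  have hI : (-Complex.I).im ≠ 0 := by simp
  -- with `‖1 / (x + i)‖ ^ 2 = π` the bound by `K` would give `π / ε ≤ K ^ 2 * π`
  set ε : ℝ := 1 / (K ^ 2 + 1) with hε
  have hpos : 0 < ε := by positivity
  set b : ℂ := a - ε * Complex.I with hb
  have him : b.im = -ε := by simp [hb, ha]
  have hneg : b.im < 0 := by rw [him]; exact neg_neg_of_pos hpos
  have h1 := h ⟨cauchy b, cauchy_mem_hardyPlus hneg⟩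
  have e : ((toep (fac a (-Complex.I)) ⟨cauchy b, cauchy_mem_hardyPlus hneg⟩ : hardyPlus) : L2R)
      = mulL (fac a b) (cauchy (-Complex.I)) := by
    rw [coe_toep_of_mem (fac_mem_plusAlg _ (by simp)), ← fac_mul_fac a hneg.ne hI, mul_comm,
      mulL_mul_apply, mulL_fac_cauchy _ hneg.ne hI]
  have h2 : ‖cauchy b‖ ≤ K * ‖mulL (fac a b) (cauchy (-Complex.I))‖ := by
    rw [← e]; exact h1
  have h3 : ‖mulL (fac a b) (cauchy (-Complex.I))‖ ≤ ‖cauchy (-Complex.I)‖ := by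
    refine (norm_mulL_le _ _).trans (mul_le_of_le_one_left (norm_nonneg _) ?_)
    have := norm_fac_le_one hneg.ne
    have hre : ((b.re : ℝ) : ℂ) = a := by
      apply Complex.ext <;> simp [hb, ha]
    rwa [hre] at this
  have h4 : ‖cauchy b‖ ^ 2 ≤ K ^ 2 * ‖cauchy (-Complex.I)‖ ^ 2 := by
    rw [← mul_pow]
    calc ‖cauchy b‖ ^ 2 ≤ (K * ‖mulL (fac a b) (cauchy (-Complex.I))‖) ^ 2 := by gcongr
      _ ≤ (K * ‖cauchy (-Complex.I)‖) ^ 2 := by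
        rw [mul_pow, mul_pow]; gcongr
  rw [norm_cauchy_sq hneg, norm_cauchy_sq (by simp), him, hε] at h4
  simp at h4
  nlinarith [Real.pi_pos]

/-- Multiplication by `1 / (x + i)` is not bounded below on `H₊`: compare the norms of
`1 / (x + i N)`, which is `(π / N) ^ (1/2)`, and of its image, which is at most `π ^ (1/2) / N`. -/
theorem not_bounded_below_res (K : ℝ) :
    ¬ ∀ u : hardyPlus, ‖u‖ ≤ K * ‖toep (res (-Complex.I)) u‖ := by
  intro h
  have hI : (-Complex.I).im ≠ 0 := by simp
  -- the bound by `K` would give `π / N ≤ K ^ 2 * π / N ^ 2`, that is, `N ≤ K ^ 2`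
  set N : ℝ := K ^ 2 + 1 with hN
  have hpos : 0 < N := by positivity
  set b : ℂ := -(N * Complex.I) with hb
  have him : b.im = -N := by simp [hb]
  have hneg : b.im < 0 := by rw [him]; exact neg_neg_of_pos hpos
  have h1 := h ⟨cauchy b, cauchy_mem_hardyPlus hneg⟩
  have e : ((toep (res (-Complex.I)) ⟨cauchy b, cauchy_mem_hardyPlus hneg⟩ : hardyPlus) : L2R)
      = mulL (res b) (cauchy (-Complex.I)) := by
    rw [coe_toep_of_mem (res_mem_plusAlg (by simp)), ← fac_mul_res hneg.ne hI, mul_comm,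
      mulL_mul_apply, mulL_fac_cauchy _ hneg.ne hI]
  have h2 : ‖cauchy b‖ ≤ K * ‖mulL (res b) (cauchy (-Complex.I))‖ := by
    rw [← e]; exact h1
  have h3 : ‖mulL (res b) (cauchy (-Complex.I))‖ ≤ N⁻¹ * ‖cauchy (-Complex.I)‖ := by
    refine (norm_mulL_le _ _).trans ?_
    have := norm_res_le hneg.ne
    rw [him, abs_neg, abs_of_pos hpos] at this
    gcongr
  have h4 : ‖cauchy b‖ ^ 2 ≤ K ^ 2 * (N⁻¹ ^ 2 * ‖cauchy (-Complex.I)‖ ^ 2) := by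
    rw [← mul_pow, ← mul_pow]
    calc ‖cauchy b‖ ^ 2 ≤ (K * ‖mulL (res b) (cauchy (-Complex.I))‖) ^ 2 := by gcongr
      _ ≤ (K * (N⁻¹ * ‖cauchy (-Complex.I)‖)) ^ 2 := by
        rw [mul_pow, mul_pow]; gcongr
  rw [norm_cauchy_sq hneg, norm_cauchy_sq (by simp), him] at h4
  simp only [neg_neg, Complex.neg_im, Complex.I_im, div_one] at h4
  have h5 : Real.pi * N ≤ K ^ 2 * Real.pi := by
    have := mul_le_mul_of_nonneg_right h4 (sq_nonneg N)
    field_simp at this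
    nlinarith
  nlinarith [Real.pi_pos]

/-! ### Operators that factor through a change of variables -/

section Factorization

variable {H : Type*} [NormedAddCommGroup H] [InnerProductSpace ℂ H]

/-- The operator `T` is, up to the injective change of variables `h = D u` with dense range, the
everywhere defined bounded operator `Ψ`: the domain of `T` is the range of `D`, and `T D = Ψ`. -/
structure FactorsThrough (T : H →ₗ.[ℂ] H) (D Ψ : H →L[ℂ] H) : Prop where
  dom : ∀ h, h ∈ T.domain ↔ ∃ u, D u = h
  apply_eq : ∀ (u : H) (h : D u ∈ T.domain), T ⟨D u, h⟩ = Ψ u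
  inj : Function.Injective D
  dense : DenseRange D

namespace FactorsThrough

variable {T : H →ₗ.[ℂ] H} {D Ψ : H →L[ℂ] H}

theorem mem (h : FactorsThrough T D Ψ) (u : H) : D u ∈ T.domain := (h.dom _).2 ⟨u, rfl⟩

theorem range_eq (h : FactorsThrough T D Ψ) : range T = Ψ.range := by
  ext y
  constructor
  · rintro ⟨⟨x, hx⟩, rfl⟩
    obtain ⟨u, rfl⟩ := (h.dom x).1 hx
    exact ⟨u, (h.apply_eq u hx).symm⟩
  · rintro ⟨u, rfl⟩
    exact ⟨⟨D u, h.mem u⟩, h.apply_eq u _⟩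

/-- The change of variables maps the kernel of `Ψ` onto the kernel of `T`. -/
def kernelEquiv (h : FactorsThrough T D Ψ) : Ψ.ker ≃ₗ[ℂ] kernel T := by
  refine LinearEquiv.ofBijective
    (LinearMap.codRestrict (kernel T)
      ((LinearMap.codRestrict T.domain D.toLinearMap h.mem) ∘ₗ Ψ.ker.subtype) ?_) ⟨?_, ?_⟩
  · intro u
    exact (h.apply_eq u _).trans u.2
  · intro u v huv
    apply Subtype.ext
    exact h.inj (congrArg (fun x : kernel T => ((x : T.domain) : H)) huv)
  · rintro ⟨⟨x, hx⟩, hk⟩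
    obtain ⟨u, rfl⟩ := (h.dom x).1 hx
    exact ⟨⟨u, (h.apply_eq u hx).symm.trans hk⟩, rfl⟩

theorem kernel_eq_bot_iff (h : FactorsThrough T D Ψ) : kernel T = ⊥ ↔ ∀ u, Ψ u = 0 → u = 0 := by
  constructor
  · intro hk u hu
    have : (⟨D u, h.mem u⟩ : T.domain) ∈ kernel T := (h.apply_eq u _).trans hu
    rw [hk, Submodule.mem_bot] at this
    apply h.inj
    rw [map_zero]
    exact congrArg Subtype.val this
  · intro hk
    rw [Submodule.eq_bot_iff]
    rintro ⟨x, hx⟩ hker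
    obtain ⟨u, rfl⟩ := (h.dom x).1 hx
    have hu := hk u ((h.apply_eq u hx).symm.trans hker)
    apply Subtype.ext
    simp [hu]

theorem regular_iff (h : FactorsThrough T D Ψ) :
    (kernel T = ⊥ ∧ Continuous fun y : T.inverse.domain => T.inverse y) ↔
      ∃ K : ℝ, ∀ u, ‖D u‖ ≤ K * ‖Ψ u‖ := by
  constructor
  · rintro ⟨hk, hc⟩
    let J : T.inverse.domain →L[ℂ] H := ⟨T.inverse.toFun, hc⟩
    refine ⟨‖J‖, fun u => ?_⟩
    have hy : T ⟨D u, h.mem u⟩ ∈ T.inverse.domain := by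
      rw [LinearPMap.inverse_domain]
      exact ⟨_, rfl⟩
    have h1 := LinearPMap.inverse_apply_eq hk (y := ⟨_, hy⟩) (x := ⟨D u, h.mem u⟩) rfl
    have h2 := J.le_opNorm ⟨_, hy⟩
    change ‖T.inverse ⟨_, hy⟩‖ ≤ ‖J‖ * ‖T ⟨D u, h.mem u⟩‖ at h2
    rwa [h1, h.apply_eq] at h2
  · rintro ⟨K, hK⟩
    have hk : kernel T = ⊥ := by
      rw [h.kernel_eq_bot_iff]
      intro u hu
      apply h.inj
      have := hK u
      rw [hu, norm_zero, mul_zero] at this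
      rw [map_zero]
      exact norm_le_zero_iff.1 this
    refine ⟨hk, ?_⟩
    refine AddMonoidHomClass.continuous_of_bound T.inverse.toFun K ?_
    rintro ⟨y, hy⟩
    obtain ⟨⟨x, hx⟩, rfl⟩ : y ∈ LinearMap.range T.toFun := by rwa [LinearPMap.inverse_domain] at hy
    obtain ⟨u, rfl⟩ := (h.dom x).1 hx
    change ‖T.inverse ⟨_, hy⟩‖ ≤ K * ‖T ⟨D u, hx⟩‖
    rw [LinearPMap.inverse_apply_eq hk (x := ⟨D u, hx⟩) rfl, h.apply_eq]
    exact hK u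

/-- If `Ψ` has a generalized inverse and a finite dimensional kernel, then `T` is closed. -/
theorem isClosed (h : FactorsThrough T D Ψ) {V : H →L[ℂ] H} (hV : Ψ * V * Ψ = Ψ)
    [FiniteDimensional ℂ Ψ.ker] : T.IsClosed := by
  have hv : ∀ u, Ψ (V (Ψ u)) = Ψ u := fun u => congrArg (fun A : H →L[ℂ] H => A u) hV
  have hset : (T.graph : Set (H × H)) = {p | Ψ (V p.2) = p.2} ∩
      (fun p : H × H => p.1 - D (V p.2)) ⁻¹' (Ψ.ker.map D.toLinearMap : Submodule ℂ H) := by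
    ext ⟨x, y⟩
    simp only [SetLike.mem_coe, LinearPMap.mem_graph_iff, Set.mem_inter_iff, Set.mem_ofPred_eq,
      Set.mem_preimage, Submodule.mem_map]
    constructor
    · rintro ⟨⟨x', hx'⟩, rfl, rfl⟩
      obtain ⟨u, rfl⟩ := (h.dom x').1 hx'
      rw [h.apply_eq]
      refine ⟨hv u, u - V (Ψ u), ?_, ?_⟩
      · change Ψ (u - V (Ψ u)) = 0
        rw [map_sub, hv, sub_self]
      · exact map_sub D u _
    · rintro ⟨h1, k, hk, h2⟩
      have hk' : Ψ k = 0 := hk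
      have h2' : D k = x - D (V y) := h2
      refine ⟨⟨D (V y + k), h.mem _⟩, ?_, ?_⟩
      · change D (V y + k) = x
        rw [map_add, h2']
        abel
      · rw [h.apply_eq, map_add, hk', add_zero, h1]
  unfold LinearPMap.IsClosed
  rw [hset]
  refine (isClosed_eq (by fun_prop) (by fun_prop)).inter ?_
  exact (Submodule.closed_of_finiteDimensional (Ψ.ker.map D.toLinearMap)).preimage (by fun_prop)

end FactorsThrough

theorem isClosed_range_of_generalized_inverse {Ψ V : H →L[ℂ] H} (hV : Ψ * V * Ψ = Ψ) :
    IsClosed (Ψ.range : Set H) := by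
  have hv : ∀ u, Ψ (V (Ψ u)) = Ψ u := fun u => congrArg (fun A : H →L[ℂ] H => A u) hV
  have : (Ψ.range : Set H) = {y | Ψ (V y) = y} := by
    ext y
    constructor
    · rintro ⟨u, rfl⟩
      exact hv u
    · intro hy
      exact ⟨V y, hy⟩
  rw [this]
  exact isClosed_eq (by fun_prop) continuous_id

/-- An injective operator with closed range is bounded below. -/
theorem exists_bound_of_isClosed_range [CompleteSpace H] {Ψ : H →L[ℂ] H}
    (hinj : Function.Injective Ψ) (hcl : IsClosed (Ψ.range : Set H)) :
    ∃ K : ℝ, ∀ u, ‖u‖ ≤ K * ‖Ψ u‖ := by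
  obtain ⟨K, hK⟩ := Ψ.antilipschitz_of_injective_of_isClosed_range hinj hcl
  exact ⟨K, Ψ.bound_of_antilipschitz hK⟩

/-- An injective operator whose range, together with a finite dimensional subspace, spans the whole
space, is bounded below. -/
theorem exists_bound_of_codisjoint [CompleteSpace H] {E : H →L[ℂ] H} (hinj : Function.Injective E)
    {N : Submodule ℂ H} [FiniteDimensional ℂ N] (h : Codisjoint E.range N) :
    ∃ K : ℝ, ∀ u, ‖u‖ ≤ K * ‖E u‖ := by
  obtain ⟨G, hGN, hG⟩ := h.symm.exists_isCompl
  have : FiniteDimensional ℂ G := Submodule.finiteDimensional_of_le hGN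
  exact exists_bound_of_isClosed_range hinj
    (E.closed_complemented_range_of_isCompl_of_ker_eq_bot G hG.symm
      (Submodule.closed_of_finiteDimensional G) (LinearMap.ker_eq_bot.2 hinj))

end Factorization

section UnitFactors

variable {H : Type*} [NormedAddCommGroup H] [NormedSpace ℂ H]

theorem mul_norm_mul_apply_le (K : ℝ) (A B : H →L[ℂ] H) (u : H) :
    K * ‖(A * B) u‖ ≤ |K| * ‖A‖ * ‖B u‖ := by
  rw [mul_assoc |K|]
  exact mul_le_mul (le_abs_self K) (A.le_opNorm (B u)) (norm_nonneg _) (abs_nonneg K)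

theorem unit_apply_inv_apply (A : (H →L[ℂ] H)ˣ) (x : H) : A.1 (A⁻¹.1 x) = x :=
  congrArg (fun B : H →L[ℂ] H => B x) A.mul_inv

theorem unit_inv_apply_apply (A : (H →L[ℂ] H)ˣ) (x : H) : A⁻¹.1 (A.1 x) = x :=
  congrArg (fun B : H →L[ℂ] H => B x) A.inv_mul

/-- An invertible bounded operator as a linear equivalence. -/
def unitEquiv (A : (H →L[ℂ] H)ˣ) : H ≃ₗ[ℂ] H :=
  LinearEquiv.ofLinearMap A.1.toLinearMap A⁻¹.1.toLinearMap
    (LinearMap.ext (unit_apply_inv_apply A)) (LinearMap.ext (unit_inv_apply_apply A))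

/-- Invertible factors do not change the kernel. -/
def kerUnitMulEquiv (A B : (H →L[ℂ] H)ˣ) (G : H →L[ℂ] H) : (A.1 * G * B.1).ker ≃ₗ[ℂ] G.ker :=
  (unitEquiv B).ofSubmodules _ _ (by
    ext x
    rw [Submodule.mem_map_equiv]
    change A.1 (G (B.1 (B⁻¹.1 x))) = 0 ↔ G x = 0
    rw [unit_apply_inv_apply]
    constructor
    · intro h
      rw [← unit_inv_apply_apply A (G x), h, map_zero]
    · intro h
      rw [h, map_zero])

/-- Invertible factors do not change the cokernel. -/
def cokerUnitMulEquiv (A B : (H →L[ℂ] H)ˣ) (G : H →L[ℂ] H) :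
    (H ⧸ G.range) ≃ₗ[ℂ] (H ⧸ (A.1 * G * B.1).range) :=
  Submodule.Quotient.equiv _ _ (unitEquiv A) (by
    ext x
    constructor
    · rintro ⟨_, ⟨y, rfl⟩, rfl⟩
      refine ⟨B⁻¹.1 y, ?_⟩
      change A.1 (G (B.1 (B⁻¹.1 y))) = A.1 (G y)
      rw [unit_apply_inv_apply]
    · rintro ⟨y, rfl⟩
      exact ⟨G (B.1 y), ⟨B.1 y, rfl⟩, rfl⟩)

theorem unit_mul_generalized_inverse (A B : (H →L[ℂ] H)ˣ) {G V : H →L[ℂ] H} (h : G * V * G = G) :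
    (A.1 * G * B.1) * (B⁻¹.1 * V * A⁻¹.1) * (A.1 * G * B.1) = A.1 * G * B.1 := by
  calc _ = A.1 * G * (B.1 * B⁻¹.1) * V * (A⁻¹.1 * A.1) * G * B.1 := by noncomm_ring
    _ = A.1 * (G * V * G) * B.1 := by
      rw [Units.mul_inv, Units.inv_mul]; noncomm_ring
    _ = _ := by rw [h]

section Toeplitz

variable {V W : H →L[ℂ] H} (A₁ A₂ : (H →L[ℂ] H)ˣ) (B : H →L[ℂ] H)

/-- The operator `A₁ * W ^ n * A₂` has the left inverse `A₂⁻¹ * V ^ n * A₁⁻¹`, so that it is bounded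
below. -/
theorem exists_bound_isometry_case (hVW : V * W = 1) (n : ℕ) :
    ∃ K : ℝ, 0 ≤ K ∧ ∀ u, ‖B u‖ ≤ K * ‖(A₁.1 * W ^ n * A₂.1 * B) u‖ := by
  refine ⟨‖A₂⁻¹.1 * V ^ n * A₁⁻¹.1‖, norm_nonneg _, fun u => ?_⟩
  have e : (A₂⁻¹.1 * V ^ n * A₁⁻¹.1) * (A₁.1 * W ^ n * A₂.1 * B) = B := by
    calc _ = A₂⁻¹.1 * V ^ n * (A₁⁻¹.1 * A₁.1) * W ^ n * A₂.1 * B := by noncomm_ring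
      _ = A₂⁻¹.1 * (V ^ n * W ^ n) * A₂.1 * B := by rw [Units.inv_mul]; noncomm_ring
      _ = _ := by rw [pow_mul_pow_of_mul_eq_one hVW, mul_one, Units.inv_mul, one_mul]
  have := (A₂⁻¹.1 * V ^ n * A₁⁻¹.1).le_opNorm ((A₁.1 * W ^ n * A₂.1 * B) u)
  rwa [← mul_apply_eq_comp, e] at this

/-- The range of an operator with the left factor `A₁ * W ^ n` is annihilated by
`(1 - W ^ n * V ^ n) * A₁⁻¹`, which is not zero if `V` is not injective. -/
theorem not_denseRange_isometry_case (hVW : V * W = 1) {e : H} (he : e ≠ 0) (hVe : V e = 0) {n : ℕ}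
    (hn : n ≠ 0) : ¬ DenseRange (A₁.1 * W ^ n * A₂.1 * B) := by
  intro hd
  have h0 : (1 - W ^ n * V ^ n) * A₁⁻¹.1 = 0 := by
    have hz : ((1 - W ^ n * V ^ n) * A₁⁻¹.1) * (A₁.1 * W ^ n * A₂.1 * B) = 0 := by
      calc _ = (1 - W ^ n * V ^ n) * (A₁⁻¹.1 * A₁.1) * W ^ n * A₂.1 * B := by noncomm_ring
        _ = (W ^ n - W ^ n * (V ^ n * W ^ n)) * A₂.1 * B := by rw [Units.inv_mul]; noncomm_ring
        _ = 0 := by rw [pow_mul_pow_of_mul_eq_one hVW, mul_one, sub_self, zero_mul, zero_mul]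
    ext1 x
    have := hd.equalizer (g := ⇑((1 - W ^ n * V ^ n) * A₁⁻¹.1)) (h := ⇑(0 : H →L[ℂ] H))
      (ContinuousLinearMap.continuous _) (ContinuousLinearMap.continuous _) (by
        ext u
        exact congrArg (fun A : H →L[ℂ] H => A u) hz)
    exact congrFun this x
  have h1 : (1 - W ^ n * V ^ n) = 0 := by
    calc (1 - W ^ n * V ^ n) = (1 - W ^ n * V ^ n) * A₁⁻¹.1 * A₁.1 := by
          rw [mul_assoc, Units.inv_mul, mul_one]
      _ = 0 := by rw [h0, zero_mul]
  have h2 : (V ^ n) e = 0 := by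
    obtain ⟨m, rfl⟩ := Nat.exists_eq_succ_of_ne_zero hn
    rw [Nat.succ_eq_add_one, pow_succ, mul_apply_eq_comp, hVe, map_zero]
  apply he
  have := congrArg (fun A : H →L[ℂ] H => A e) h1
  simpa [h2] using this

theorem surjective_coisometry_case (hVW : V * W = 1) (k : ℕ) :
    Function.Surjective (A₁.1 * V ^ k * A₂.1) := by
  intro y
  refine ⟨(A₂⁻¹.1 * W ^ k * A₁⁻¹.1) y, ?_⟩
  rw [← mul_apply_eq_comp]
  have e : (A₁.1 * V ^ k * A₂.1) * (A₂⁻¹.1 * W ^ k * A₁⁻¹.1) = 1 := by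
    calc _ = A₁.1 * V ^ k * (A₂.1 * A₂⁻¹.1) * W ^ k * A₁⁻¹.1 := by noncomm_ring
      _ = A₁.1 * (V ^ k * W ^ k) * A₁⁻¹.1 := by rw [Units.mul_inv]; noncomm_ring
      _ = _ := by rw [pow_mul_pow_of_mul_eq_one hVW, mul_one, Units.mul_inv]
  rw [e]; rfl

theorem denseRange_coisometry_case (hVW : V * W = 1) (k : ℕ) (hB : DenseRange B) :
    DenseRange (A₁.1 * V ^ k * A₂.1 * B) :=
  (surjective_coisometry_case A₁ A₂ hVW k).denseRange.comp hB (ContinuousLinearMap.continuous _)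

theorem unit_mul_injective {B : H →L[ℂ] H} (hB : Function.Injective B) :
    Function.Injective (A₂.1 * B) :=
  (unitEquiv A₂).injective.comp hB

/-- A bound below for `A₂ * B` gives one for `B`. -/
theorem exists_bound_of_unit_mul {B : H →L[ℂ] H} (h : ∃ K : ℝ, ∀ u, ‖u‖ ≤ K * ‖(A₂.1 * B) u‖) :
    ∃ K : ℝ, ∀ u, ‖u‖ ≤ K * ‖B u‖ := by
  obtain ⟨K, hK⟩ := h
  exact ⟨|K| * ‖A₂.1‖, fun u => (hK u).trans (mul_norm_mul_apply_le K A₂.1 B u)⟩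

end Toeplitz

end UnitFactors

section Fredholm

variable {H : Type*} [NormedAddCommGroup H] [InnerProductSpace ℂ H]

theorem FactorsThrough.dense_domain {T : H →ₗ.[ℂ] H} {D Ψ : H →L[ℂ] H}
    (h : FactorsThrough T D Ψ) : Dense (T.domain : Set H) := by
  have : (T.domain : Set H) = Set.range D := Set.ext h.dom
  rw [this]
  exact h.dense

/-- An operator that is equivalent to `G` is Fredholm, with the dimensions of `G`, if `G` has a
generalized inverse and a finite dimensional kernel and cokernel. -/
theorem FactorsThrough.isFredholm {T : H →ₗ.[ℂ] H} {D G V : H →L[ℂ] H} {A B : (H →L[ℂ] H)ˣ}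
    (h : FactorsThrough T D (A.1 * G * B.1)) (hV : G * V * G = G)
    [FiniteDimensional ℂ G.ker] [FiniteDimensional ℂ (H ⧸ G.range)] :
    IsFredholm T ∧ Module.finrank ℂ (kernel T) = Module.finrank ℂ G.ker ∧
      Module.finrank ℂ (H ⧸ range T) = Module.finrank ℂ (H ⧸ G.range) := by
  have hV' := unit_mul_generalized_inverse A B hV
  have : FiniteDimensional ℂ (A.1 * G * B.1).ker :=
    Module.Finite.equiv (kerUnitMulEquiv A B G).symm
  have : FiniteDimensional ℂ (H ⧸ (A.1 * G * B.1).range) :=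
    Module.Finite.equiv (cokerUnitMulEquiv A B G)
  have hcl : IsClosed ((A.1 * G * B.1).range : Set H) := isClosed_range_of_generalized_inverse hV'
  refine ⟨⟨h.dense_domain, h.isClosed hV', Module.Finite.equiv h.kernelEquiv, ?_, ?_⟩, ?_, ?_⟩
  · rw [h.range_eq]; assumption
  · rw [h.range_eq]; exact hcl
  · rw [← h.kernelEquiv.finrank_eq, (kerUnitMulEquiv A B G).finrank_eq]
  · rw [h.range_eq, (cokerUnitMulEquiv A B G).finrank_eq]

end Fredholm

section ClosedRange

variable {H : Type*} [NormedAddCommGroup H] [InnerProductSpace ℂ H] [CompleteSpace H]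
variable {V W : H →L[ℂ] H} (A₁ A₂ : (H →L[ℂ] H)ˣ) {B : H →L[ℂ] H}

theorem exists_bound_of_isClosed_range_isometry_case (hVW : V * W = 1) (n : ℕ)
    (hB : Function.Injective B)
    (hcl : IsClosed ((A₁.1 * W ^ n * A₂.1 * B).range : Set H)) :
    ∃ K : ℝ, ∀ u, ‖u‖ ≤ K * ‖B u‖ := by
  obtain ⟨K₁, -, h₁⟩ := exists_bound_isometry_case A₁ A₂ B hVW n
  have hinj : Function.Injective (A₁.1 * W ^ n * A₂.1 * B) := by
    rw [injective_iff_map_eq_zero]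
    intro u hu
    have := h₁ u
    rw [hu, norm_zero, mul_zero, norm_le_zero_iff] at this
    exact (injective_iff_map_eq_zero B).1 hB u this
  obtain ⟨K, hK⟩ := exists_bound_of_isClosed_range hinj hcl
  exact ⟨|K| * ‖A₁.1 * W ^ n * A₂.1‖,
    fun u => (hK u).trans (mul_norm_mul_apply_le K (A₁.1 * W ^ n * A₂.1) B u)⟩

/-- The range is dense. If it is also closed, then it is the whole space, so that the range of
`A₂ * B` and the finite dimensional kernel of `V ^ k` together span the space. -/
theorem exists_bound_of_isClosed_range_coisometry_case (hVW : V * W = 1) (k : ℕ)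
    [FiniteDimensional ℂ (V ^ k).ker] (hB : Function.Injective B) (hd : DenseRange B)
    (hcl : IsClosed ((A₁.1 * V ^ k * A₂.1 * B).range : Set H)) :
    ∃ K : ℝ, ∀ u, ‖u‖ ≤ K * ‖B u‖ := by
  have hdense := denseRange_coisometry_case A₁ A₂ B hVW k hd
  have hsurj : ∀ y, ∃ u, (A₁.1 * V ^ k * A₂.1 * B) u = y := by
    intro y
    have h2 : closure ((A₁.1 * V ^ k * A₂.1 * B).range : Set H) = Set.univ := hdense.closure_range
    rw [hcl.closure_eq] at h2
    have h3 : y ∈ ((A₁.1 * V ^ k * A₂.1 * B).range : Set H) := by rw [h2]; trivial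
    exact h3
  refine exists_bound_of_unit_mul A₂ (exists_bound_of_codisjoint (unit_mul_injective A₂ hB)
    (N := (V ^ k).ker) ?_)
  rw [codisjoint_iff, eq_top_iff]
  intro y _
  obtain ⟨u, hu⟩ := hsurj (A₁.1 ((V ^ k) y))
  have hu' : (V ^ k) ((A₂.1 * B) u) = (V ^ k) y := by
    have := congrArg A₁⁻¹.1 hu
    rw [unit_inv_apply_apply] at this
    rw [← this]
    exact (unit_inv_apply_apply A₁ _).symm
  rw [Submodule.mem_sup]
  refine ⟨(A₂.1 * B) u, ⟨u, rfl⟩, y - (A₂.1 * B) u, ?_, by abel⟩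
  change (V ^ k) (y - (A₂.1 * B) u) = 0
  rw [map_sub, hu', sub_self]

end ClosedRange

/-! ### Outer factors -/

theorem ae_ne (a : ℂ) : ∀ᵐ x : ℝ, (x : ℂ) ≠ a := by
  have h : ∀ᵐ x : ℝ, x ≠ a.re := by
    simp [ae_iff, measure_singleton]
  filter_upwards [h] with x hx h2
  apply hx
  rw [← h2, Complex.ofReal_re]

/-- A nonzero polynomial is not square integrable. -/
theorem eq_zero_of_memLp_polynomial {p : ℂ[X]} (h : MemLp (fun x : ℝ => p.eval (x : ℂ)) 2) :
    p = 0 := by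
  by_contra hp
  obtain ⟨c, hc, M, hM⟩ : ∃ c : ℝ, 0 < c ∧ ∃ M : ℝ, ∀ x : ℝ, M ≤ x → c ≤ ‖p.eval (x : ℂ)‖ := by
    by_cases hd : 0 < p.degree
    · have ht : Tendsto (fun x : ℝ => ‖(x : ℂ)‖) atTop atTop := by
        simp only [Complex.norm_real]
        exact tendsto_norm_atTop_atTop
      have := p.tendsto_norm_atTop hd ht
      obtain ⟨M, hM⟩ := (this.eventually_ge_atTop 1).exists_forall_of_atTop
      exact ⟨1, one_pos, M, hM⟩
    · have h0 : p = C (p.coeff 0) := eq_C_of_degree_le_zero (not_lt.1 hd)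
      refine ⟨‖p.coeff 0‖, ?_, 0, fun x _ => ?_⟩
      · rw [norm_pos_iff]
        intro h
        rw [h, C_0] at h0
        exact hp h0
      · conv_rhs => rw [h0, eval_C]
  have h1 : MemLp (fun _ : ℝ => c) 2 (volume.restrict (Set.Ioi M)) := by
    refine (h.restrict (Set.Ioi M)).mono aestronglyMeasurable_const ?_
    filter_upwards [ae_restrict_mem measurableSet_Ioi] with x hx
    rw [Real.norm_of_nonneg hc.le]
    exact hM x (le_of_lt hx)
  rw [memLp_const_iff (by norm_num) (by norm_num)] at h1
  simp [hc.ne'] at h1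

/-- A square integrable function which is a quotient of polynomials, with a denominator that has
real zeros only, vanishes: square integrability forces the zeros of the denominator to cancel, and
the remaining polynomial is not square integrable. -/
theorem eq_zero_of_prod_mul_ae_eq_polynomial {s : Multiset ℂ} (hs : ∀ a ∈ s, a.im = 0) {v : L2R}
    {p : ℂ[X]} (h : ∀ᵐ x : ℝ, (s.map fun a => (x : ℂ) - a).prod * v x = p.eval (x : ℂ)) :
    v = 0 := by
  induction s using Multiset.induction generalizing p with
  | empty =>
    have hv : v =ᵐ[volume] fun x : ℝ => p.eval (x : ℂ) := by
      filter_upwards [h] with x hx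
      simpa using hx
    have hp := eq_zero_of_memLp_polynomial ((memLp_congr_ae hv).1 (Lp.memLp v))
    rw [Lp.eq_zero_iff_ae_eq_zero]
    filter_upwards [hv] with x hx
    rw [hx, hp]
    simp
  | cons a s ih =>
    have ha : ((a.re : ℝ) : ℂ) = a := by
      have := hs a (Multiset.mem_cons_self _ _)
      apply Complex.ext <;> simp [this]
    have hroot : p.IsRoot a := by
      by_contra hpa
      rw [IsRoot, ← ha] at hpa
      set t := a.re with ht
      set f : ℝ → ℂ := fun x => p.eval (x : ℂ) / ((x : ℂ) - a) with hf
      have hO : (fun x : ℝ => (x - t)⁻¹) =O[𝓝[≠] t] f := by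
        have hcont : Continuous fun x : ℝ => ‖p.eval (x : ℂ)‖ :=
          (p.continuous.comp Complex.continuous_ofReal).norm
        have hpos : 0 < ‖p.eval (t : ℂ)‖ := norm_pos_iff.2 hpa
        have hev : ∀ᶠ x : ℝ in 𝓝 t, ‖p.eval (t : ℂ)‖ / 2 < ‖p.eval (x : ℂ)‖ :=
          (hcont.tendsto t).eventually_const_lt (by linarith)
        refine Asymptotics.IsBigO.of_bound (2 / ‖p.eval (t : ℂ)‖) ?_
        filter_upwards [nhdsWithin_le_nhds hev] with x hx
        have e : ‖(x - t)⁻¹‖ = ‖((x : ℂ) - a)⁻¹‖ := by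
          rw [← ha, ← Complex.ofReal_sub, ← Complex.ofReal_inv, Complex.norm_real]
        change _ ≤ _ * ‖p.eval (x : ℂ) / ((x : ℂ) - a)‖
        rw [e, div_eq_mul_inv _ ((x : ℂ) - a), norm_mul, ← mul_assoc]
        refine le_mul_of_one_le_left (norm_nonneg _) ?_
        rw [div_mul_eq_mul_div, one_le_div hpos]
        linarith
      refine not_intervalIntegrable_of_sub_inv_isBigO_punctured hO (a := t - 1) (b := t + 1)
        (by linarith) (by rw [Set.uIcc_of_le (by linarith)]; constructor <;> linarith) ?_
      rw [intervalIntegrable_iff_integrableOn_Icc_of_le (by linarith)]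
      have hprod : Continuous fun x : ℝ => (s.map fun a => (x : ℂ) - a).prod :=
        continuous_multiset_prod s fun i _ => by fun_prop
      have hv : IntegrableOn (fun x => v x) (Set.Icc (t - 1) (t + 1)) :=
        ((Lp.memLp v).locallyIntegrable (by norm_num)).integrableOn_isCompact isCompact_Icc
      have := hv.continuousOn_mul hprod.continuousOn isCompact_Icc
      refine this.congr_fun_ae (ae_restrict_of_ae ?_)
      filter_upwards [h, ae_ne a] with x hx hne
      rw [Multiset.map_cons, Multiset.prod_cons] at hx
      change _ = p.eval (x : ℂ) / ((x : ℂ) - a)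
      rw [← hx]
      have := sub_ne_zero.2 hne
      field_simp
    obtain ⟨q, rfl⟩ := dvd_iff_isRoot.2 hroot
    refine ih (fun b hb => hs b (Multiset.mem_cons_of_mem hb)) (p := q) ?_
    filter_upwards [h, ae_ne a] with x hx hne
    rw [Multiset.map_cons, Multiset.prod_cons, eval_mul, eval_sub, eval_X, eval_C, mul_assoc] at hx
    exact mul_left_cancel₀ (sub_ne_zero.2 hne) hx

/-- The rational function `∏ (x - b) / (x - a) ^ n`, where `b` runs through the multiset `s` with
`n` elements. -/
def facs (s : Multiset ℂ) (a : ℂ) : ℝ →ᵇ ℂ := (s.map fun b => fac b a).prod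

/-- The reciprocal of `facs s a`. -/
def facsInv (s : Multiset ℂ) (a : ℂ) : ℝ →ᵇ ℂ := (s.map fun b => fac a b).prod

theorem bcf_pow_apply (φ : ℝ →ᵇ ℂ) (n : ℕ) (x : ℝ) : (φ ^ n) x = φ x ^ n := by
  rw [BoundedContinuousFunction.coe_pow, Pi.pow_apply]

theorem facs_apply (s : Multiset ℂ) {a : ℂ} (ha : a.im ≠ 0) (x : ℝ) :
    facs s a x = (s.map fun b => (x : ℂ) - b).prod / ((x : ℂ) - a) ^ s.card := by
  induction s using Multiset.induction with
  | empty => simp [facs]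
  | cons b s ih =>
    have : facs (b ::ₘ s) a = fac b a * facs s a := by
      rw [facs, Multiset.map_cons, Multiset.prod_cons, facs]
    rw [this, BoundedContinuousFunction.mul_apply, ih, fac_apply _ ha, Multiset.map_cons,
      Multiset.prod_cons, Multiset.card_cons, pow_succ', div_mul_div_comm]

theorem facs_mul_facsInv {s : Multiset ℂ} (hs : ∀ b ∈ s, b.im ≠ 0) {a : ℂ} (ha : a.im ≠ 0) :
    facs s a * facsInv s a = 1 := by
  rw [facs, facsInv, ← Multiset.prod_map_mul, ← Multiset.prod_map_one (m := s)]
  congr 1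
  exact Multiset.map_congr rfl fun b hb => by rw [fac_mul_fac _ ha (hs b hb), fac_self]

theorem facs_mem_plusAlg (s : Multiset ℂ) {a : ℂ} (ha : a.im < 0) : facs s a ∈ plusAlg := by
  refine Subalgebra.multiset_prod_mem _ fun φ hφ => ?_
  obtain ⟨b, -, rfl⟩ := Multiset.mem_map.1 hφ
  exact fac_mem_plusAlg _ ha

theorem facsInv_mem_plusAlg {s : Multiset ℂ} (hs : ∀ b ∈ s, b.im < 0) (a : ℂ) :
    facsInv s a ∈ plusAlg := by
  refine Subalgebra.multiset_prod_mem _ fun φ hφ => ?_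
  obtain ⟨b, hb, rfl⟩ := Multiset.mem_map.1 hφ
  exact fac_mem_plusAlg _ (hs b hb)

theorem star_facs (s : Multiset ℂ) (a : ℂ) : star (facs s a) = facs (s.map conj) (conj a) := by
  induction s using Multiset.induction with
  | empty => simp [facs]
  | cons b s ih =>
    simp only [facs, Multiset.map_cons, Multiset.prod_cons, star_mul'] at ih ⊢
    rw [star_fac, ih]

theorem star_facsInv (s : Multiset ℂ) (a : ℂ) :
    star (facsInv s a) = facsInv (s.map conj) (conj a) := by
  induction s using Multiset.induction with
  | empty => simp [facsInv]
  | cons b s ih =>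
    simp only [facsInv, Multiset.map_cons, Multiset.prod_cons, star_mul'] at ih ⊢
    rw [star_fac, ih]

theorem star_facs_mem_plusAlg (s : Multiset ℂ) {a : ℂ} (ha : 0 < a.im) :
    star (facs s a) ∈ plusAlg := by
  rw [star_facs]
  exact facs_mem_plusAlg _ (by simpa using ha)

theorem star_facsInv_mem_plusAlg {s : Multiset ℂ} (hs : ∀ b ∈ s, 0 < b.im) (a : ℂ) :
    star (facsInv s a) ∈ plusAlg := by
  rw [star_facsInv]
  refine facsInv_mem_plusAlg (fun b hb => ?_) _
  obtain ⟨c, hc, rfl⟩ := Multiset.mem_map.1 hb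
  simpa using hs c hc

theorem fac_pow_card_mul_facs (s : Multiset ℂ) {a b : ℂ} (ha : a.im ≠ 0) (hb : b.im ≠ 0) :
    fac b a ^ s.card * facs s b = facs s a := by
  induction s using Multiset.induction with
  | empty => simp [facs]
  | cons c s ih =>
    have h : ∀ d, facs (c ::ₘ s) d = fac c d * facs s d := fun d => by
      rw [facs, Multiset.map_cons, Multiset.prod_cons, facs]
    rw [h, h, ← ih, ← fac_mul_fac c ha hb, Multiset.card_cons]
    ring

/-- For a multiset of real points and an exponent, the outer function
`∏ (x - b) / (x + i) ^ (n + m)`. -/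
def outerFactor (s : Multiset ℂ) (m : ℕ) : ℝ →ᵇ ℂ := facs s (-Complex.I) * res (-Complex.I) ^ m

theorem isOuter_outerFactor {s : Multiset ℂ} (hs : ∀ b ∈ s, b.im = 0) (m : ℕ) :
    IsOuter (outerFactor s m) := by
  refine IsOuter.mul (IsOuter.multiset_prod fun φ hφ => ?_) (isOuter_res.pow m)
  obtain ⟨b, hb, rfl⟩ := Multiset.mem_map.1 hφ
  exact isOuter_fac (hs b hb)

theorem outerFactor_apply (s : Multiset ℂ) (m : ℕ) (x : ℝ) :
    outerFactor s m x =
      (s.map fun b => (x : ℂ) - b).prod / ((x : ℂ) + Complex.I) ^ (s.card + m) := by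
  rw [outerFactor, BoundedContinuousFunction.mul_apply, facs_apply _ (by simp), bcf_pow_apply,
    res_apply (by simp), sub_neg_eq_add, pow_add, inv_pow]
  field_simp

theorem isCoprime_fac_res (a : ℂ) : IsCoprime (fac a (-Complex.I)) (res (-Complex.I)) := by
  refine ⟨1, -((-Complex.I - a) • 1), ?_⟩
  rw [one_mul, fac, neg_mul, smul_mul_assoc, one_mul]
  abel

theorem isCoprime_fac_fac {a b : ℂ} (hab : a ≠ b) :
    IsCoprime (fac a (-Complex.I)) (fac b (-Complex.I)) := by
  have h : b - a ≠ 0 := sub_ne_zero.2 hab.symm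
  refine ⟨((-Complex.I - b) / (a - b)) • 1, ((-Complex.I - a) / (b - a)) • 1, ?_⟩
  have h' : a - b ≠ 0 := sub_ne_zero.2 hab
  simp only [fac, smul_mul_assoc, one_mul]
  have e : b - a = -(a - b) := by ring
  match_scalars
  · rw [e]; field_simp; ring
  · rw [e]; field_simp; ring

theorem isCoprime_multiset_prod_left {R : Type*} [CommSemiring R] {s : Multiset R} {x : R}
    (h : ∀ y ∈ s, IsCoprime y x) : IsCoprime s.prod x := by
  induction s using Multiset.induction with
  | empty => rw [Multiset.prod_zero]; exact isCoprime_one_left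
  | cons a s ih =>
    rw [Multiset.prod_cons]
    exact (h a (Multiset.mem_cons_self _ _)).mul_left
      (ih fun y hy => h y (Multiset.mem_cons_of_mem hy))

/-- Two outer factors without common zeros in `ℝ ∪ {∞}` generate the unit ideal. -/
theorem isCoprime_outerFactor {s t : Multiset ℂ} (hst : ∀ a ∈ s, a ∉ t) {m d : ℕ}
    (hmd : m = 0 ∨ d = 0) : IsCoprime (outerFactor s m) (outerFactor t d) := by
  have h1 : ∀ (u : Multiset ℂ) (n : ℕ), IsCoprime (facs u (-Complex.I)) (res (-Complex.I) ^ n) := by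
    intro u n
    refine IsCoprime.pow_right (isCoprime_multiset_prod_left fun φ hφ => ?_)
    obtain ⟨b, -, rfl⟩ := Multiset.mem_map.1 hφ
    exact isCoprime_fac_res b
  have h2 : IsCoprime (facs s (-Complex.I)) (facs t (-Complex.I)) := by
    refine isCoprime_multiset_prod_left fun φ hφ => ?_
    obtain ⟨b, hb, rfl⟩ := Multiset.mem_map.1 hφ
    refine (isCoprime_multiset_prod_left fun φ hφ => ?_).symm
    obtain ⟨c, hc, rfl⟩ := Multiset.mem_map.1 hφ
    exact isCoprime_fac_fac fun h => hst b hb (h ▸ hc)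
  have h3 : IsCoprime (res (-Complex.I) ^ m) (res (-Complex.I) ^ d) := by
    rcases hmd with rfl | rfl
    · rw [pow_zero]; exact isCoprime_one_left
    · rw [pow_zero]; exact isCoprime_one_right
  exact ((h2.mul_right (h1 s d))).mul_left (((h1 t m).symm).mul_right h3)

/-- A nontrivial outer factor is not bounded below on `H₊`. -/
theorem not_bounded_below_outerFactor {s : Multiset ℂ} (hs : ∀ b ∈ s, b.im = 0) {m : ℕ}
    (hsm : s.card + m ≠ 0) (K : ℝ) : ¬ ∀ u : hardyPlus, ‖u‖ ≤ K * ‖toep (outerFactor s m) u‖ := by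
  have key : ∀ {φ χ : ℝ →ᵇ ℂ}, φ ∈ plusAlg → outerFactor s m = χ * φ →
      (∀ u : hardyPlus, ‖u‖ ≤ K * ‖toep (outerFactor s m) u‖) →
      ∀ u : hardyPlus, ‖u‖ ≤ (|K| * ‖toep χ‖) * ‖toep φ u‖ := by
    intro φ χ hφ he h u
    refine (h u).trans ?_
    rw [he, toep_mul_of_mem_right _ hφ]
    exact mul_norm_mul_apply_le K (toep χ) (toep φ) u
  intro h
  rcases s.empty_or_exists_mem with rfl | ⟨a, ha⟩
  · have hm : m ≠ 0 := by simpa using hsm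
    obtain ⟨n, rfl⟩ := Nat.exists_eq_succ_of_ne_zero hm
    refine not_bounded_below_res _ (key (χ := facs 0 (-Complex.I) * res (-Complex.I) ^ n)
      (res_mem_plusAlg (by simp)) ?_ h)
    rw [outerFactor, Nat.succ_eq_add_one, pow_succ, mul_assoc]
  · obtain ⟨t, rfl⟩ := Multiset.exists_cons_of_mem ha
    refine not_bounded_below_fac (hs a ha) _ (key (χ := facs t (-Complex.I) * res (-Complex.I) ^ m)
      (fac_mem_plusAlg _ (by simp)) ?_ h)
    rw [outerFactor, facs, Multiset.map_cons, Multiset.prod_cons, facs]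
    ring

/-! ### The Toeplitz operator of a factorized symbol -/

/-- The Toeplitz operator of an outer factor `B` with `b` zeros in `ℝ ∪ {∞}`, followed by the `k`-th
power of `coBlaschkeOp`, is not injective precisely if `b < k`: an element `v` of the kernel is of
the form `p (x + i) ^ (b - k) / ∏ (x - a)` with a polynomial `p`, and `v = (x + i) ^ (b - k)` is an
instance if `b < k`. -/
theorem exists_coBlaschkeOp_pow_outerFactor_eq_zero_iff {s : Multiset ℂ} (hs : ∀ a ∈ s, a.im = 0)
    (m k : ℕ) :
    (∃ v : hardyPlus, v ≠ 0 ∧ (coBlaschkeOp ^ k) (toep (outerFactor s m) v) = 0) ↔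
      s.card + m < k := by
  have hI : (-Complex.I).im ≠ 0 := by simp
  have hB := isOuter_outerFactor hs m
  constructor
  · rintro ⟨v, hv, h⟩
    by_contra hk
    obtain ⟨j, hj⟩ := Nat.exists_eq_add_of_le (not_lt.1 hk)
    obtain ⟨p, -, hp⟩ := exists_polynomial_of_coBlaschkeOp_pow_eq_zero k h
    apply hv
    apply Subtype.ext
    refine eq_zero_of_prod_mul_ae_eq_polynomial hs (p := p * (X + C Complex.I) ^ j) ?_
    rw [coe_toep_of_mem hB.mem] at hp
    filter_upwards [hp, mulL_ae_eq (outerFactor s m) v] with x h1 h2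
    rw [h2, outerFactor_apply, hj] at h1
    have hx : (x : ℂ) + Complex.I ≠ 0 := by
      simpa using ofReal_sub_ne_zero hI x
    simp only [eval_mul, eval_pow, eval_add, eval_X, eval_C, ← h1]
    rw [pow_add]
    field_simp
  · intro hk
    obtain ⟨j, rfl⟩ := Nat.exists_eq_add_of_lt hk
    have hres := isOuter_res.pow j
    refine ⟨toep (res (-Complex.I) ^ j) kerVec, ?_, ?_⟩
    · intro h
      exact kerVec_ne_zero (hres.toep_injective (by rw [h, map_zero]))
    · have e : fac (-Complex.I) Complex.I ^ (s.card + m + j + 1) *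
          (outerFactor s m * res (-Complex.I) ^ j) =
          (facs s Complex.I * res Complex.I ^ (m + j)) * fac (-Complex.I) Complex.I := by
        rw [← fac_pow_card_mul_facs s (by simp) hI, ← fac_mul_res (a := Complex.I) (by simp) hI,
          outerFactor]
        ring
      have hstar : star (facs s Complex.I * res Complex.I ^ (m + j)) ∈ plusAlg := by
        rw [star_mul', star_pow]
        exact mul_mem (star_facs_mem_plusAlg _ (by simp))
          (pow_mem (star_res_mem_plusAlg (by simp)) _)
      rw [coBlaschkeOp, ← toep_pow_of_star_mem (star_fac_mem_plusAlg _ (by simp)),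
        ← mul_apply_eq_comp, ← mul_apply_eq_comp, mul_assoc,
        ← toep_mul_of_mem_right _ hres.mem, ← toep_mul_of_mem_right _ (mul_mem hB.mem hres.mem), e,
        toep_mul_of_star_mem_left hstar, mul_apply_eq_comp]
      have := coBlaschkeOp_kerVec
      rw [coBlaschkeOp] at this
      rw [this, map_zero]

/-- An invertible symbol whose conjugate multiplies `H₊` into itself, as does the conjugate of the
inverse, has an invertible Toeplitz operator. -/
def toepUnitOfStar (A : (ℝ →ᵇ ℂ)ˣ) (h : star A.1 ∈ plusAlg) (h' : star A⁻¹.1 ∈ plusAlg) :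
    (hardyPlus →L[ℂ] hardyPlus)ˣ where
  val := toep A.1
  inv := toep A⁻¹.1
  val_inv := by rw [← toep_mul_of_star_mem_left h, Units.mul_inv, toep_one]
  inv_val := by rw [← toep_mul_of_star_mem_left h', Units.inv_mul, toep_one]

/-- A symbol which, together with its inverse, multiplies `H₊` into itself, has an invertible
Toeplitz operator. -/
def toepUnit (A : (ℝ →ᵇ ℂ)ˣ) (h : A.1 ∈ plusAlg) (h' : A⁻¹.1 ∈ plusAlg) :
    (hardyPlus →L[ℂ] hardyPlus)ˣ where
  val := toep A.1
  inv := toep A⁻¹.1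
  val_inv := by rw [← toep_mul_of_mem_right _ h', Units.mul_inv, toep_one]
  inv_val := by rw [← toep_mul_of_mem_right _ h, Units.inv_mul, toep_one]

/-- A Wiener-Hopf factorization of the operator `T`: up to the change of variables `h = D u` with an
outer factor `D`, the operator `T` is the Toeplitz operator with the symbol
`A₁ w ^ r (1 / w) ^ s A₂ B`, where `w` is the Blaschke factor `(x - i) / (x + i)`, where `A₁` and
`A₂` are invertible among the analytic symbols of the lower and of the upper half-plane,
respectively, and where `B` is an outer factor with `b` zeros in `ℝ ∪ {∞}`, none of which is a zero
of `D`. -/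
structure WienerHopfModel (T : hardyPlus →ₗ.[ℂ] hardyPlus) (r s b : ℕ) where
  /-- the real zeros of `D` -/
  zerosD : Multiset ℂ
  /-- the order of the zero of `D` at infinity -/
  ordD : ℕ
  /-- the real zeros of `B` -/
  zerosB : Multiset ℂ
  /-- the order of the zero of `B` at infinity -/
  ordB : ℕ
  /-- the invertible symbol that is analytic in the lower half-plane -/
  A₁ : (ℝ →ᵇ ℂ)ˣ
  /-- the invertible symbol that is analytic in the upper half-plane -/
  A₂ : (ℝ →ᵇ ℂ)ˣ
  real_zerosD : ∀ a ∈ zerosD, a.im = 0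
  real_zerosB : ∀ a ∈ zerosB, a.im = 0
  disjoint_zeros : ∀ a ∈ zerosD, a ∉ zerosB
  disjoint_infty : ordD = 0 ∨ ordB = 0
  card_eq : zerosB.card + ordB = b
  star_mem₁ : star A₁.1 ∈ plusAlg
  star_inv_mem₁ : star A₁⁻¹.1 ∈ plusAlg
  mem₂ : A₂.1 ∈ plusAlg
  inv_mem₂ : A₂⁻¹.1 ∈ plusAlg
  factors : FactorsThrough T (toep (outerFactor zerosD ordD))
    (toep (A₁.1 * (fac Complex.I (-Complex.I) ^ r * fac (-Complex.I) Complex.I ^ s) *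
      (A₂.1 * outerFactor zerosB ordB)))

namespace WienerHopfModel

variable {T : hardyPlus →ₗ.[ℂ] hardyPlus} {r s b : ℕ}

/-- The outer factor `B`. -/
def B (M : WienerHopfModel T r s b) : ℝ →ᵇ ℂ := outerFactor M.zerosB M.ordB

/-- The outer factor `D`. -/
def D (M : WienerHopfModel T r s b) : ℝ →ᵇ ℂ := outerFactor M.zerosD M.ordD

/-- The symbol of the Toeplitz operator. -/
def symbol (M : WienerHopfModel T r s b) : ℝ →ᵇ ℂ :=
  M.A₁.1 * (fac Complex.I (-Complex.I) ^ r * fac (-Complex.I) Complex.I ^ s) * (M.A₂.1 * M.B)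

/-- The Toeplitz operator of `A₁`. -/
def op₁ (M : WienerHopfModel T r s b) : (hardyPlus →L[ℂ] hardyPlus)ˣ :=
  toepUnitOfStar M.A₁ M.star_mem₁ M.star_inv_mem₁

/-- The Toeplitz operator of `A₂`. -/
def op₂ (M : WienerHopfModel T r s b) : (hardyPlus →L[ℂ] hardyPlus)ˣ :=
  toepUnit M.A₂ M.mem₂ M.inv_mem₂

theorem outer_B (M : WienerHopfModel T r s b) : IsOuter M.B := isOuter_outerFactor M.real_zerosB _

theorem outer_D (M : WienerHopfModel T r s b) : IsOuter M.D := isOuter_outerFactor M.real_zerosD _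

theorem factorsThrough (M : WienerHopfModel T r s b) :
    FactorsThrough T (toep M.D) (toep M.symbol) := M.factors

theorem toep_symbol (M : WienerHopfModel T r s b) : toep M.symbol = M.op₁.1 *
    toep (fac Complex.I (-Complex.I) ^ r * fac (-Complex.I) Complex.I ^ s) * M.op₂.1 *
      toep M.B := by
  rw [symbol, toep_mul_of_mem_right _ (mul_mem M.mem₂ M.outer_B.mem),
    toep_mul_of_star_mem_left M.star_mem₁, toep_mul_of_mem_right _ M.outer_B.mem, ← mul_assoc]
  rfl

theorem toep_symbol_of_le (M : WienerHopfModel T r s b) (h : s ≤ r) :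
    toep M.symbol = M.op₁.1 * blaschkeOp ^ (r - s) * M.op₂.1 * toep M.B := by
  obtain ⟨n, rfl⟩ := Nat.exists_eq_add_of_le h
  rw [M.toep_symbol, pow_add, mul_right_comm, ← mul_pow, fac_mul_fac _ (by simp) (by simp),
    fac_self, one_pow, one_mul, toep_pow_of_mem (fac_mem_plusAlg _ (by simp)),
    Nat.add_sub_cancel_left]
  rfl

theorem toep_symbol_of_ge (M : WienerHopfModel T r s b) (h : r ≤ s) :
    toep M.symbol = M.op₁.1 * coBlaschkeOp ^ (s - r) * M.op₂.1 * toep M.B := by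
  obtain ⟨n, rfl⟩ := Nat.exists_eq_add_of_le h
  rw [M.toep_symbol, pow_add, ← mul_assoc, ← mul_pow, fac_mul_fac _ (by simp) (by simp),
    fac_self, one_pow, one_mul, toep_pow_of_star_mem (star_fac_mem_plusAlg _ (by simp)),
    Nat.add_sub_cancel_left]
  rfl

theorem B_of_eq_zero (M : WienerHopfModel T r s b) (hb : b = 0) : M.B = 1 := by
  have h := M.card_eq.trans hb
  rw [Nat.add_eq_zero_iff, Multiset.card_eq_zero] at h
  rw [B, outerFactor, h.1, h.2, pow_zero, mul_one, facs, Multiset.map_zero,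
    Multiset.prod_zero]

theorem toep_B_of_eq_zero (M : WienerHopfModel T r s b) (hb : b = 0) : toep M.B = 1 := by
  rw [M.B_of_eq_zero hb, toep_one]

theorem isUnit_symbol (M : WienerHopfModel T r s b) (hb : b = 0) : IsUnit M.symbol := by
  have hw : fac Complex.I (-Complex.I) * fac (-Complex.I) Complex.I = 1 := by
    rw [fac_mul_fac _ (by simp) (by simp), fac_self]
  rw [symbol, M.B_of_eq_zero hb, mul_one]
  exact (M.A₁.isUnit.mul (((IsUnit.of_mul_eq_one _ hw).pow r).mul
    ((IsUnit.of_mul_eq_one _ (by rw [mul_comm, hw])).pow s))).mul M.A₂.isUnit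

theorem not_bounded_below_B (M : WienerHopfModel T r s b) (hb : b ≠ 0) (K : ℝ) :
    ¬ ∀ u, ‖u‖ ≤ K * ‖toep M.B u‖ :=
  not_bounded_below_outerFactor M.real_zerosB (by rw [M.card_eq]; exact hb) K

/-- Since `D` and `B` generate the unit ideal, `B` would be bounded below if it dominated `D`. -/
theorem eq_zero_of_bound (M : WienerHopfModel T r s b) {K : ℝ}
    (h : ∀ u, ‖toep M.D u‖ ≤ K * ‖toep M.B u‖) : b = 0 := by
  by_contra hb
  obtain ⟨α, β, hαβ⟩ := isCoprime_outerFactor M.disjoint_zeros M.disjoint_infty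
  refine M.not_bounded_below_B hb (‖α‖ * K + ‖β‖) fun u => ?_
  have e : (u : L2R) = mulL α (toep M.D u : hardyPlus) + mulL β (toep M.B u : hardyPlus) := by
    rw [coe_toep_of_mem M.outer_B.mem,
      coe_toep_of_mem M.outer_D.mem, ← mulL_mul_apply,
      ← mulL_mul_apply, ← _root_.add_apply, ← map_add, D, B, hαβ, map_one]
    rfl
  calc ‖u‖ = ‖mulL α (toep M.D u : hardyPlus) + mulL β (toep M.B u : hardyPlus)‖ := by
        rw [← e]; rfl
    _ ≤ ‖α‖ * ‖toep M.D u‖ + ‖β‖ * ‖toep M.B u‖ :=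
        (norm_add_le _ _).trans (add_le_add (norm_mulL_le _ _) (norm_mulL_le _ _))
    _ ≤ ‖α‖ * (K * ‖toep M.B u‖) + ‖β‖ * ‖toep M.B u‖ := by gcongr; exact h u
    _ = _ := by ring

/-- If the symbol dominates `D`, then `B` has no zeros in `ℝ ∪ {∞}`. -/
theorem eq_zero_of_symbol_bound (M : WienerHopfModel T r s b) {χ : ℝ →ᵇ ℂ}
    (hχ : M.symbol = χ * M.B) {K : ℝ} (h : ∀ x, ‖M.D x‖ ≤ K * ‖M.symbol x‖) : b = 0 := by
  refine M.eq_zero_of_bound (K := |K| * ‖χ‖) fun u => ?_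
  refine Lp.norm_le_mul_norm_of_ae_le_mul ?_
  change ∀ᵐ x : ℝ, ‖(toep M.D u : L2R) x‖ ≤ |K| * ‖χ‖ * ‖(toep M.B u : L2R) x‖
  rw [coe_toep_of_mem M.outer_B.mem, coe_toep_of_mem M.outer_D.mem]
  filter_upwards [mulL_ae_eq M.D u, mulL_ae_eq M.B u] with x h1 h2
  rw [h1, h2, norm_mul, norm_mul, ← mul_assoc]
  gcongr
  refine (h x).trans ?_
  rw [hχ, BoundedContinuousFunction.mul_apply, norm_mul, ← mul_assoc]
  gcongr
  · exact le_abs_self K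
  · exact χ.norm_coe_le_norm x

theorem dense_range_iff (M : WienerHopfModel T r s b) :
    Dense (range T : Set hardyPlus) ↔ r ≤ s := by
  rw [M.factorsThrough.range_eq]
  change DenseRange (toep M.symbol) ↔ _
  constructor
  · intro h
    by_contra hrs
    rw [M.toep_symbol_of_le (by omega)] at h
    exact not_denseRange_isometry_case _ _ _ coBlaschkeOp_mul_blaschkeOp kerVec_ne_zero
      coBlaschkeOp_kerVec (by omega) h
  · intro h
    rw [M.toep_symbol_of_ge h]
    exact denseRange_coisometry_case _ _ _ coBlaschkeOp_mul_blaschkeOp _ M.outer_B.dense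

theorem op₂_mul_comm (M : WienerHopfModel T r s b) :
    M.op₂.1 * toep M.B = toep M.B * M.op₂.1 := by
  change toep M.A₂.1 * toep M.B = toep M.B * toep M.A₂.1
  rw [← toep_mul_of_mem_right _ M.outer_B.mem, ← toep_mul_of_mem_right _ M.mem₂, mul_comm]

theorem kernel_ne_bot_iff (M : WienerHopfModel T r s b) : kernel T ≠ ⊥ ↔ b + r < s := by
  rw [ne_eq, M.factorsThrough.kernel_eq_bot_iff]
  rcases le_total s r with h | h
  · refine iff_of_false (not_not.2 fun u hu => ?_) (by omega)
    obtain ⟨K, -, hK⟩ := exists_bound_isometry_case M.op₁ M.op₂ (toep M.B)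
      coBlaschkeOp_mul_blaschkeOp (r - s)
    have := hK u
    rw [← M.toep_symbol_of_le h, hu, norm_zero, mul_zero, norm_le_zero_iff] at this
    exact M.outer_B.toep_injective (by rw [this, map_zero])
  · have key := exists_coBlaschkeOp_pow_outerFactor_eq_zero_iff M.real_zerosB M.ordB (s - r)
    rw [M.card_eq] at key
    rw [show b + r < s ↔ b < s - r by omega, ← key, M.toep_symbol_of_ge h]
    have e : ∀ u, (M.op₁.1 * coBlaschkeOp ^ (s - r) * M.op₂.1 * toep M.B) u =
        M.op₁.1 ((coBlaschkeOp ^ (s - r)) (toep M.B (M.op₂.1 u))) := by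
      intro u
      rw [mul_assoc, M.op₂_mul_comm]
      rfl
    push Not
    constructor
    · rintro ⟨u, hu, hu0⟩
      rw [e] at hu
      refine ⟨M.op₂.1 u, fun h0 => hu0 ?_, ?_⟩
      · exact (map_eq_zero_iff (unitEquiv M.op₂) (unitEquiv M.op₂).injective).1 h0
      · exact (map_eq_zero_iff (unitEquiv M.op₁) (unitEquiv M.op₁).injective).1 hu
    · rintro ⟨v, hv0, hv⟩
      refine ⟨M.op₂⁻¹.1 v, ?_, fun h0 => hv0 ?_⟩
      · rw [e, unit_apply_inv_apply]
        exact (congrArg M.op₁.1 hv).trans (map_zero _)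
      · rw [← unit_apply_inv_apply M.op₂ v, h0, map_zero]

theorem eq_zero_of_isClosed_range (M : WienerHopfModel T r s b)
    (h : IsClosed (range T : Set hardyPlus)) : b = 0 := by
  by_contra hb
  rw [M.factorsThrough.range_eq] at h
  suffices ∃ K : ℝ, ∀ u, ‖u‖ ≤ K * ‖toep M.B u‖ by
    obtain ⟨K, hK⟩ := this
    exact M.not_bounded_below_B hb K hK
  rcases le_total s r with hrs | hrs
  · rw [M.toep_symbol_of_le hrs] at h
    exact exists_bound_of_isClosed_range_isometry_case _ _ coBlaschkeOp_mul_blaschkeOp _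
      M.outer_B.toep_injective h
  · rw [M.toep_symbol_of_ge hrs] at h
    have := (finrank_ker_coBlaschkeOp_pow (s - r)).1
    exact exists_bound_of_isClosed_range_coisometry_case _ _ coBlaschkeOp_mul_blaschkeOp _
      M.outer_B.toep_injective M.outer_B.dense h

theorem regular_iff (M : WienerHopfModel T r s b) :
    (kernel T = ⊥ ∧ Continuous fun y : T.inverse.domain => T.inverse y) ↔ b = 0 ∧ s ≤ r := by
  constructor
  · intro h
    have hk := h.1
    obtain ⟨K, hK⟩ := M.factorsThrough.regular_iff.1 h
    have hb : b = 0 := by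
      rw [M.toep_symbol] at hK
      exact M.eq_zero_of_bound fun u => (hK u).trans (mul_norm_mul_apply_le K _ (toep M.B) u)
    refine ⟨hb, ?_⟩
    by_contra hrs
    exact M.kernel_ne_bot_iff.2 (by omega) hk
  · rintro ⟨hb, hrs⟩
    rw [M.factorsThrough.regular_iff]
    obtain ⟨K, hK0, hK⟩ := exists_bound_isometry_case M.op₁ M.op₂ (toep M.B)
      coBlaschkeOp_mul_blaschkeOp (r - s)
    refine ⟨‖toep M.D‖ * K, fun u => ((toep M.D).le_opNorm u).trans ?_⟩
    rw [mul_assoc]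
    gcongr
    have := hK u
    rwa [← M.toep_symbol_of_le hrs, M.toep_B_of_eq_zero hb] at this

/-- The Fredholm case: without the factor `B`, the operator `T` is equivalent to a power of
`blaschkeOp` or of `coBlaschkeOp`. -/
theorem fredholm (M : WienerHopfModel T r s b) (hb : b = 0) :
    IsFredholm T ∧ Module.finrank ℂ (kernel T) = s - r ∧
      Module.finrank ℂ (hardyPlus ⧸ range T) = r - s := by
  have hF := M.factorsThrough
  suffices h : ∃ G V : hardyPlus →L[ℂ] hardyPlus, G * V * G = G ∧
      toep M.symbol = M.op₁.1 * G * M.op₂.1 ∧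
      (FiniteDimensional ℂ G.ker ∧ Module.finrank ℂ G.ker = s - r) ∧
      (FiniteDimensional ℂ (hardyPlus ⧸ G.range) ∧
        Module.finrank ℂ (hardyPlus ⧸ G.range) = r - s) by
    obtain ⟨G, V, hV, hG, ⟨hk, hk'⟩, hc, hc'⟩ := h
    rw [hG] at hF
    have key := hF.isFredholm hV
    rw [hk', hc'] at key
    exact key
  rcases le_total s r with hrs | hrs
  · refine ⟨blaschkeOp ^ (r - s), coBlaschkeOp ^ (r - s), ?_, ?_, ?_, ?_⟩
    · rw [mul_assoc, pow_mul_pow_of_mul_eq_one coBlaschkeOp_mul_blaschkeOp, mul_one]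
    · rw [M.toep_symbol_of_le hrs, M.toep_B_of_eq_zero hb, mul_one]
    · have : (blaschkeOp ^ (r - s)).ker = ⊥ := by
        rw [Submodule.eq_bot_iff]
        intro x hx
        have hx' : (blaschkeOp ^ (r - s)) x = 0 := hx
        have := congrArg (fun A : hardyPlus →L[ℂ] hardyPlus => A x)
          (pow_mul_pow_of_mul_eq_one coBlaschkeOp_mul_blaschkeOp (r - s))
        simp only [mul_apply_eq_comp, hx', map_zero] at this
        exact this.symm
      rw [this, finrank_bot]
      exact ⟨inferInstance, by omega⟩
    · obtain ⟨h1, h2⟩ := finrank_ker_coBlaschkeOp_pow (r - s)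
      have e := Submodule.quotientEquivOfIsCompl _ _ (isCompl_range_ker_of_mul_eq_one
        (pow_mul_pow_of_mul_eq_one coBlaschkeOp_mul_blaschkeOp (r - s)))
      exact ⟨Module.Finite.equiv e.symm, e.finrank_eq.trans h2⟩
  · refine ⟨coBlaschkeOp ^ (s - r), blaschkeOp ^ (s - r), ?_, ?_, ?_, ?_⟩
    · rw [pow_mul_pow_of_mul_eq_one coBlaschkeOp_mul_blaschkeOp, one_mul]
    · rw [M.toep_symbol_of_ge hrs, M.toep_B_of_eq_zero hb, mul_one]
    · exact finrank_ker_coBlaschkeOp_pow (s - r)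
    · have : (coBlaschkeOp ^ (s - r)).range = ⊤ := by
        rw [LinearMap.range_eq_top]
        intro y
        exact ⟨(blaschkeOp ^ (s - r)) y, congrArg (fun A : hardyPlus →L[ℂ] hardyPlus => A y)
          (pow_mul_pow_of_mul_eq_one coBlaschkeOp_mul_blaschkeOp (s - r))⟩
      rw [this]
      exact ⟨inferInstance, by rw [Module.finrank_zero_of_subsingleton]; omega⟩

end WienerHopfModel

/-! ### Symbols of the operators with a rational symbol -/

theorem ae_eval_ne_zero {Q : ℂ[X]} (hQ : Q ≠ 0) : ∀ᵐ x : ℝ, Q.eval (x : ℂ) ≠ 0 := by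
  have hfin : {x : ℝ | Q.eval (x : ℂ) = 0}.Finite := by
    refine Set.Finite.of_finite_image (f := fun x : ℝ => (x : ℂ)) ?_
      (Complex.ofReal_injective.injOn)
    refine (Q.roots.toFinset.finite_toSet).subset ?_
    rintro _ ⟨x, hx, rfl⟩
    simpa [hQ] using hx
  filter_upwards [hfin.countable.ae_notMem volume] with x hx
  exact hx

/-- If the symbols `D` and `ψ` generate the unit ideal and `D` is outer, and if `ψ / D = κ - z`,
then `M₊(κ) - z` is up to the change of variables `h = D u` the Toeplitz operator of `ψ`. -/
theorem factorsThrough_of_symbol {P Q : ℂ[X]} (hQ : Q ≠ 0) (z : ℂ) {D ψ : ℝ →ᵇ ℂ} (hD : IsOuter D)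
    (hc : IsCoprime D ψ)
    (h : ∀ x : ℝ, ψ x * Q.eval (x : ℂ) = (P - C z * Q).eval (x : ℂ) * D x) :
    FactorsThrough (shift (mPlus (ratSymbol P Q)) z) (toep D) (toep ψ) := by
  have hκ : ∀ x : ℝ, Q.eval (x : ℂ) ≠ 0 → ratSymbol P Q x * D x = z * D x + ψ x := by
    intro x hx
    have := h x
    rw [eval_sub, eval_mul, eval_C] at this
    rw [ratSymbol]
    field_simp
    linear_combination -this
  have hae : ∀ u : hardyPlus, (fun x : ℝ => ratSymbol P Q x * (toep D u : L2R) x) =ᵐ[volume]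
      (z • (toep D u : L2R) + mulL ψ u : L2R) := by
    intro u
    filter_upwards [ae_eval_ne_zero hQ, mulL_ae_eq D u, mulL_ae_eq ψ u,
      Lp.coeFn_add (z • (toep D u : L2R)) (mulL ψ u), Lp.coeFn_smul z (toep D u : L2R)]
      with x h1 h2 h3 h4 h5
    rw [h4, Pi.add_apply, h5, Pi.smul_apply, h3, coe_toep_of_mem hD.mem, h2, ← mul_assoc, hκ x h1,
      smul_eq_mul]
    ring
  have hmem : ∀ u : hardyPlus, toep D u ∈ (shift (mPlus (ratSymbol P Q)) z).domain := by
    intro u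
    change MemLp (fun x => ratSymbol P Q x * (toep D u : L2R) x) 2 volume
    exact (memLp_congr_ae (hae u)).2 (Lp.memLp _)
  refine ⟨fun g => ⟨fun hg => ?_, ?_⟩, fun u hu => ?_, hD.toep_injective, hD.dense⟩
  · change MemLp (fun x => ratSymbol P Q x * (g : L2R) x) 2 volume at hg
    obtain ⟨α, β, hαβ⟩ := hc
    -- `u = α g + β (κ - z) g` solves `D u = g`, since `α D + β ψ = 1`
    set u : L2R := mulL α g + mulL β (hg.toLp _ - z • (g : L2R)) with hu
    have hDu : mulL D u = g := by
      ext1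
      filter_upwards [mulL_ae_eq D u, Lp.coeFn_add (mulL α g) (mulL β (hg.toLp _ - z • (g : L2R))),
        mulL_ae_eq α g, mulL_ae_eq β (hg.toLp _ - z • (g : L2R)),
        Lp.coeFn_sub (hg.toLp _) (z • (g : L2R)), hg.coeFn_toLp, Lp.coeFn_smul z (g : L2R),
        ae_eval_ne_zero hQ] with x h1 h2 h3 h4 h5 h6 h7 h8
      rw [h1, hu, h2, Pi.add_apply, h3, h4, h5, Pi.sub_apply, h6, h7, Pi.smul_apply, smul_eq_mul]
      have e : α x * D x + β x * ψ x = 1 := by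
        have := congrArg (fun φ : ℝ →ᵇ ℂ => φ x) hαβ
        simpa using this
      have e2 := hκ x h8
      linear_combination (g : L2R) x * e + β x * (g : L2R) x * e2
    have hu' : u ∈ hardyPlus := hD.of_mul_mem u (by rw [hDu]; exact g.2)
    refine ⟨⟨u, hu'⟩, Subtype.ext ?_⟩
    rw [coe_toep_of_mem hD.mem]
    exact hDu
  · rintro ⟨u, rfl⟩
    exact hmem u
  · change hardyPlus.orthogonalProjectionOnto
      (MemLp.toLp (fun x => ratSymbol P Q x * (toep D u : L2R) x) hu) - z • toep D u = toep ψ u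
    have e : MemLp.toLp (fun x => ratSymbol P Q x * (toep D u : L2R) x) hu =
        z • (toep D u : L2R) + mulL ψ u := by
      ext1
      exact hu.coeFn_toLp.trans (hae u)
    rw [e, map_add, map_smul, Submodule.orthogonalProjectionOnto_mem_subspace_eq_self,
      add_sub_cancel_left]
    rfl

open scoped Classical in
/-- The zeros of `P` in `S`, with multiplicities. -/
def zerosIn (S : Set ℂ) (P : ℂ[X]) : Multiset ℂ := P.roots.filter (· ∈ S)

open scoped Classical in
theorem mem_of_mem_zerosIn {S : Set ℂ} {P : ℂ[X]} {a : ℂ} (h : a ∈ zerosIn S P) : a ∈ S :=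
  (Multiset.mem_filter.1 h).2

open scoped Classical in
theorem isRoot_of_mem_zerosIn {S : Set ℂ} {P : ℂ[X]} {a : ℂ} (h : a ∈ zerosIn S P) : P.IsRoot a :=
  isRoot_of_mem_roots (Multiset.mem_filter.1 h).1

theorem natDegree_partIn (S : Set ℂ) (P : ℂ[X]) : (partIn S P).natDegree = (zerosIn S P).card :=
  natDegree_multiset_prod_X_sub_C_eq_card _

theorem zerosIn_union {S S' : Set ℂ} (h : Disjoint S S') (P : ℂ[X]) :
    zerosIn (S ∪ S') P = zerosIn S P + zerosIn S' P := by
  classical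
  ext a
  simp only [zerosIn, Multiset.count_add, Multiset.count_filter, Set.mem_union]
  by_cases h1 : a ∈ S
  · have : a ∉ S' := fun h2 => Set.disjoint_left.1 h h1 h2
    simp [h1, this]
  · simp [h1]

/-- The open upper half-plane. -/
abbrev upper : Set ℂ := {a | 0 < a.im}

/-- The open lower half-plane. -/
abbrev lower : Set ℂ := {a | a.im < 0}

/-- The real line. -/
abbrev realLine : Set ℂ := {a | a.im = 0}

theorem zerosIn_nonneg (P : ℂ[X]) :
    zerosIn {a | 0 ≤ a.im} P = zerosIn upper P + zerosIn realLine P := by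
  rw [← zerosIn_union]
  · congr 1
    ext a
    change 0 ≤ a.im ↔ 0 < a.im ∨ a.im = 0
    rw [le_iff_lt_or_eq, eq_comm]
  · rw [Set.disjoint_left]
    intro a (h1 : 0 < a.im) (h2 : a.im = 0)
    exact h1.ne' h2

theorem zerosIn_nonpos (P : ℂ[X]) :
    zerosIn {a | a.im ≤ 0} P = zerosIn lower P + zerosIn realLine P := by
  rw [← zerosIn_union]
  · congr 1
    ext a
    change a.im ≤ 0 ↔ a.im < 0 ∨ a.im = 0
    rw [le_iff_lt_or_eq]
  · rw [Set.disjoint_left]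
    intro a (h1 : a.im < 0) (h2 : a.im = 0)
    exact h1.ne h2

theorem roots_eq_add (P : ℂ[X]) :
    P.roots = zerosIn upper P + zerosIn realLine P + zerosIn lower P := by
  rw [← zerosIn_nonneg, ← zerosIn_union]
  · have : ({a | 0 ≤ a.im} ∪ lower : Set ℂ) = Set.univ := by
      ext a
      simpa using le_or_gt 0 a.im
    rw [this, zerosIn]
    simp
  · rw [Set.disjoint_left]
    intro a (h1 : 0 ≤ a.im) (h2 : a.im < 0)
    exact absurd h2 (not_lt.2 h1)

theorem natDegree_eq_card_add (P : ℂ[X]) : P.natDegree =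
    (zerosIn upper P).card + (zerosIn realLine P).card + (zerosIn lower P).card := by
  rw [← Multiset.card_add, ← Multiset.card_add, ← roots_eq_add,
    (IsAlgClosed.splits P).natDegree_eq_card_roots]

theorem eval_eq_prod (P : ℂ[X]) (x : ℂ) : P.eval x = P.leadingCoeff *
    ((zerosIn upper P).map fun a => x - a).prod * ((zerosIn realLine P).map fun a => x - a).prod *
      ((zerosIn lower P).map fun a => x - a).prod := by
  rw [(IsAlgClosed.splits P).eval_eq_prod_roots, mul_assoc, mul_assoc, ← mul_assoc
    ((zerosIn upper P).map fun a => x - a).prod, ← Multiset.prod_add, ← Multiset.prod_add,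
    ← Multiset.map_add, ← Multiset.map_add, ← roots_eq_add]

theorem facsInv_apply {s : Multiset ℂ} (hs : ∀ b ∈ s, b.im ≠ 0) {a : ℂ} (ha : a.im ≠ 0) (x : ℝ) :
    facsInv s a x = ((x : ℂ) - a) ^ s.card / (s.map fun b => (x : ℂ) - b).prod := by
  have h := congrArg (fun φ : ℝ →ᵇ ℂ => φ x) (facs_mul_facsInv hs ha)
  simp only [BoundedContinuousFunction.mul_apply, BoundedContinuousFunction.coe_one,
    Pi.one_apply] at h
  rw [eq_inv_of_mul_eq_one_right h, facs_apply _ ha, inv_div]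

/-- The quotient `facs s a / facs t a` as an invertible symbol. -/
def facsUnit {s t : Multiset ℂ} (hs : ∀ b ∈ s, b.im ≠ 0) (ht : ∀ b ∈ t, b.im ≠ 0) {a : ℂ}
    (ha : a.im ≠ 0) : (ℝ →ᵇ ℂ)ˣ where
  val := facs s a * facsInv t a
  inv := facs t a * facsInv s a
  val_inv := by
    rw [mul_mul_mul_comm, mul_comm (facsInv t a), mul_mul_mul_comm, facs_mul_facsInv hs ha,
      facs_mul_facsInv ht ha, one_mul]
  inv_val := by
    rw [mul_mul_mul_comm, mul_comm (facsInv s a), mul_mul_mul_comm, facs_mul_facsInv ht ha,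
      facs_mul_facsInv hs ha, one_mul]

/-! ### The factorization of a rational symbol -/

theorem star_facsUnit_mem {s t : Multiset ℂ} (ht : ∀ b ∈ t, 0 < b.im) :
    star (facs s Complex.I * facsInv t Complex.I) ∈ plusAlg := by
  rw [star_mul']
  exact mul_mem (star_facs_mem_plusAlg _ (by simp)) (star_facsInv_mem_plusAlg ht _)

theorem facsUnit_mem {s t : Multiset ℂ} (ht : ∀ b ∈ t, b.im < 0) :
    facs s (-Complex.I) * facsInv t (-Complex.I) ∈ plusAlg :=
  mul_mem (facs_mem_plusAlg _ (by simp)) (facsInv_mem_plusAlg ht _)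

/-- The zeros of `D` are the real zeros of `Q`, and a zero at infinity that accounts for the pole of
`κ - z = R / Q` at infinity. The zeros of `B` are those of `R / Q` in `ℝ ∪ {∞}`. -/
theorem exists_wienerHopfModel {P Q R : ℂ[X]} (hQ : Q ≠ 0) {z : ℂ} (hR : R = P - C z * Q)
    (hR0 : R ≠ 0) (hRQ : IsCoprime R Q) :
    ∃ M : WienerHopfModel (shift (mPlus (ratSymbol P Q)) z) (zerosIn upper R).card
      (zerosIn upper Q).card ((zerosIn realLine R).card + (Q.natDegree - R.natDegree)),
      ∀ x : ℝ, M.symbol x * Q.eval (x : ℂ) = R.eval (x : ℂ) * M.D x := by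
  have hI : Complex.I.im ≠ 0 := by simp
  have hI' : (-Complex.I).im ≠ 0 := by simp
  have hup : ∀ P : ℂ[X], ∀ b ∈ zerosIn upper P, 0 < b.im := fun P b hb => mem_of_mem_zerosIn hb
  have hlo : ∀ P : ℂ[X], ∀ b ∈ zerosIn lower P, b.im < 0 := fun P b hb => mem_of_mem_zerosIn hb
  have hre : ∀ P : ℂ[X], ∀ b ∈ zerosIn realLine P, b.im = 0 := fun P b hb => mem_of_mem_zerosIn hb
  have hup' : ∀ P : ℂ[X], ∀ b ∈ zerosIn upper P, b.im ≠ 0 := fun P b hb => (hup P b hb).ne'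
  have hlo' : ∀ P : ℂ[X], ∀ b ∈ zerosIn lower P, b.im ≠ 0 := fun P b hb => (hlo P b hb).ne
  have hc : R.leadingCoeff / Q.leadingCoeff ≠ 0 :=
    div_ne_zero (leadingCoeff_ne_zero.2 hR0) (leadingCoeff_ne_zero.2 hQ)
  let A₀ : (ℝ →ᵇ ℂ)ˣ := facsUnit (hup' R) (hup' Q) hI
  let A₁ : (ℝ →ᵇ ℂ)ˣ :=
    { val := (R.leadingCoeff / Q.leadingCoeff) • A₀.1
      inv := (R.leadingCoeff / Q.leadingCoeff)⁻¹ • A₀⁻¹.1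
      val_inv := by rw [smul_mul_smul_comm, mul_inv_cancel₀ hc, Units.mul_inv, one_smul]
      inv_val := by rw [smul_mul_smul_comm, inv_mul_cancel₀ hc, Units.inv_mul, one_smul] }
  let A₂ : (ℝ →ᵇ ℂ)ˣ := facsUnit (hlo' R) (hlo' Q) hI'
  have hdisj : ∀ a ∈ zerosIn realLine Q, a ∉ zerosIn realLine R := by
    intro a h1 h2
    have h3 := isRoot_of_mem_zerosIn h1
    have h4 := isRoot_of_mem_zerosIn h2
    obtain ⟨u, v, huv⟩ := hRQ
    have := congrArg (eval a) huv
    rw [eval_add, eval_mul, eval_mul, h3.eq_zero, h4.eq_zero] at this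
    simp at this
  have hinfty : R.natDegree - Q.natDegree = 0 ∨ Q.natDegree - R.natDegree = 0 := by omega
  set D := outerFactor (zerosIn realLine Q) (R.natDegree - Q.natDegree) with hD
  set B := outerFactor (zerosIn realLine R) (Q.natDegree - R.natDegree) with hB
  set r := (zerosIn upper R).card with hr
  set s := (zerosIn upper Q).card with hs
  set ψ := A₁.1 * (fac Complex.I (-Complex.I) ^ r * fac (-Complex.I) Complex.I ^ s) * (A₂.1 * B)
    with hψ
  have hsym : ∀ x : ℝ, ψ x * Q.eval (x : ℂ) = R.eval (x : ℂ) * D x := by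
    intro x
    have hu : (x : ℂ) + Complex.I ≠ 0 := by simpa using ofReal_sub_ne_zero hI' x
    have hv : (x : ℂ) - Complex.I ≠ 0 := ofReal_sub_ne_zero hI x
    have hprod : ∀ s : Multiset ℂ, (∀ b ∈ s, b.im ≠ 0) →
        (s.map fun b => (x : ℂ) - b).prod ≠ 0 := by
      intro s hs h0
      rw [Multiset.prod_eq_zero_iff, Multiset.mem_map] at h0
      obtain ⟨b, hb, hb0⟩ := h0
      exact ofReal_sub_ne_zero (hs b hb) x hb0
    have h1 := hprod _ (hup' Q)
    have h2 := hprod _ (hlo' Q)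
    have hq := leadingCoeff_ne_zero.2 hQ
    -- both exponents of `x + i` are equal since
    -- `deg Q + (deg R - deg Q) = deg R + (deg Q - deg R)` for truncated differences
    have hdeg : ((x : ℂ) + Complex.I) ^ (s + (zerosIn lower Q).card +
          ((zerosIn realLine Q).card + (R.natDegree - Q.natDegree))) =
        ((x : ℂ) + Complex.I) ^ (r + (zerosIn lower R).card +
          ((zerosIn realLine R).card + (Q.natDegree - R.natDegree))) := by
      congr 1
      have := natDegree_eq_card_add Q
      have := natDegree_eq_card_add R
      omega
    have e1 : A₁.1 x = R.leadingCoeff / Q.leadingCoeff *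
        (facs (zerosIn upper R) Complex.I x * facsInv (zerosIn upper Q) Complex.I x) := rfl
    have e2 : A₂.1 x = facs (zerosIn lower R) (-Complex.I) x *
        facsInv (zerosIn lower Q) (-Complex.I) x := rfl
    rw [eval_eq_prod Q, eval_eq_prod R, hψ, hD, outerFactor_apply]
    simp only [BoundedContinuousFunction.mul_apply, bcf_pow_apply]
    rw [e1, e2, hB, outerFactor_apply, facs_apply _ hI, facs_apply _ hI', facsInv_apply (hup' Q) hI,
      facsInv_apply (hlo' Q) hI', fac_apply _ hI, fac_apply _ hI', ← hr, ← hs]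
    simp only [sub_neg_eq_add, div_pow]
    generalize (Multiset.map (fun b => (x : ℂ) - b) (zerosIn upper Q)).prod = q₁ at *
    generalize (Multiset.map (fun b => (x : ℂ) - b) (zerosIn lower Q)).prod = q₂ at *
    generalize (Multiset.map (fun b => (x : ℂ) - b) (zerosIn realLine Q)).prod = q₃ at *
    generalize (Multiset.map (fun b => (x : ℂ) - b) (zerosIn upper R)).prod = r₁ at *
    generalize (Multiset.map (fun b => (x : ℂ) - b) (zerosIn lower R)).prod = r₂ at *
    generalize (Multiset.map (fun b => (x : ℂ) - b) (zerosIn realLine R)).prod = r₃ at *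
    generalize (zerosIn realLine R).card + (Q.natDegree - R.natDegree) = k at *
    generalize (zerosIn realLine Q).card + (R.natDegree - Q.natDegree) = l at *
    generalize (zerosIn lower R).card = r' at *
    generalize (zerosIn lower Q).card = s' at *
    generalize (x : ℂ) + Complex.I = u at *
    generalize (x : ℂ) - Complex.I = v at *
    rw [pow_add, pow_add, pow_add, pow_add] at hdeg
    have hk := hdeg
    have e3 : u ^ s * u ^ s' / (u ^ r * u ^ r' * u ^ k) = 1 / u ^ l := by
      rw [div_eq_div_iff (by positivity) (by positivity)]
      linear_combination hk
    calc _ = R.leadingCoeff * r₁ * r₂ * r₃ * q₃ * (u ^ s * u ^ s' / (u ^ r * u ^ r' * u ^ k)) := by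
          field_simp
      _ = _ := by rw [e3]; field_simp
  have hDB : IsCoprime D B := isCoprime_outerFactor hdisj hinfty
  have hw : fac Complex.I (-Complex.I) * fac (-Complex.I) Complex.I = 1 := by
    rw [fac_mul_fac _ hI' hI, fac_self]
  have hunit : IsUnit (fac Complex.I (-Complex.I) ^ r * fac (-Complex.I) Complex.I ^ s) :=
    ((IsUnit.of_mul_eq_one _ hw).pow r).mul ((IsUnit.of_mul_eq_one _ (by rw [mul_comm, hw])).pow s)
  have hDψ : IsCoprime D ψ := by
    rw [hψ, isCoprime_mul_unit_left_right (A₁.isUnit.mul hunit),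
      isCoprime_mul_unit_left_right A₂.isUnit]
    exact hDB
  refine ⟨{ zerosD := zerosIn realLine Q
            ordD := R.natDegree - Q.natDegree
            zerosB := zerosIn realLine R
            ordB := Q.natDegree - R.natDegree
            A₁ := A₁
            A₂ := A₂
            real_zerosD := hre Q
            real_zerosB := hre R
            disjoint_zeros := hdisj
            disjoint_infty := hinfty
            card_eq := rfl
            star_mem₁ := ?_
            star_inv_mem₁ := ?_
            mem₂ := facsUnit_mem (hlo Q)
            inv_mem₂ := facsUnit_mem (hlo R)
            factors := ?_ }, hsym⟩
  · change star ((R.leadingCoeff / Q.leadingCoeff) • _) ∈ plusAlg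
    rw [star_smul]
    exact Subalgebra.smul_mem _ (star_facsUnit_mem (hup Q)) _
  · change star ((R.leadingCoeff / Q.leadingCoeff)⁻¹ • _) ∈ plusAlg
    rw [star_smul]
    exact Subalgebra.smul_mem _ (star_facsUnit_mem (hup R)) _
  · refine factorsThrough_of_symbol hQ z (isOuter_outerFactor (hre Q) _) hDψ ?_
    rw [← hR]
    exact hsym

/-- The range of `κ` stays away from `z` precisely if `κ - z = R / Q` has no zeros in `ℝ ∪ {∞}`. -/
theorem notMem_closure_ratRange_iff {P Q R : ℂ[X]} {z : ℂ} (hR : R = P - C z * Q)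
    (hRQ : IsCoprime R Q) {T : hardyPlus →ₗ.[ℂ] hardyPlus} {r s b : ℕ} (M : WienerHopfModel T r s b)
    (hM : ∀ x : ℝ, M.symbol x * Q.eval (x : ℂ) = R.eval (x : ℂ) * M.D x) :
    z ∉ closure (ratRange P Q) ↔ b = 0 := by
  have hval : ∀ x : ℝ, Q.eval (x : ℂ) ≠ 0 →
      ‖M.symbol x‖ = dist z (ratSymbol P Q x) * ‖M.D x‖ := by
    intro x hx
    have h1 : M.symbol x = (ratSymbol P Q x - z) * M.D x := by
      have := hM x
      rw [hR, eval_sub, eval_mul, eval_C] at this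
      rw [ratSymbol]
      field_simp
      linear_combination this
    rw [h1, norm_mul, dist_comm, dist_eq_norm]
  constructor
  · intro hz
    rw [Metric.mem_closure_iff] at hz
    push Not at hz
    obtain ⟨ε, hε, hz⟩ := hz
    refine M.eq_zero_of_symbol_bound (K := ε⁻¹)
      (χ := M.A₁.1 * (fac Complex.I (-Complex.I) ^ r * fac (-Complex.I) Complex.I ^ s) * M.A₂.1)
      (by rw [WienerHopfModel.symbol, mul_assoc _ M.A₂.1]) fun x => ?_
    by_cases hx : Q.eval (x : ℂ) = 0
    · have hRx : R.eval (x : ℂ) ≠ 0 := by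
        intro h0
        obtain ⟨u, v, huv⟩ := hRQ
        have := congrArg (eval (x : ℂ)) huv
        rw [eval_add, eval_mul, eval_mul, hx, h0] at this
        simp at this
      have := hM x
      rw [hx, mul_zero, eq_comm, mul_eq_zero] at this
      rw [this.resolve_left hRx, norm_zero]
      positivity
    · rw [hval x hx, ← mul_assoc]
      refine le_mul_of_one_le_left (norm_nonneg _) ?_
      rw [inv_mul_eq_div, one_le_div hε]
      exact hz _ ⟨x, hx, rfl⟩
  · rintro hb hz
    obtain ⟨δ, hδ, hlow⟩ : ∃ δ > 0, ∀ x, δ ≤ ‖M.symbol x‖ := by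
      obtain ⟨χ, hχ⟩ := (M.isUnit_symbol hb).exists_right_inv
      refine ⟨(‖χ‖ + 1)⁻¹, by positivity, fun x => ?_⟩
      have h1 := congrArg (fun φ : ℝ →ᵇ ℂ => ‖φ x‖) hχ
      simp only [BoundedContinuousFunction.mul_apply, BoundedContinuousFunction.coe_one,
        Pi.one_apply, norm_mul, norm_one] at h1
      rw [inv_le_iff_one_le_mul₀ (by positivity), ← h1]
      gcongr
      exact (χ.norm_coe_le_norm x).trans (by linarith)
    rw [Metric.mem_closure_iff] at hz
    obtain ⟨w, ⟨x, hx, rfl⟩, hw⟩ := hz (δ / (‖M.D‖ + 1)) (by positivity)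
    have h1 := hlow x
    rw [hval x hx] at h1
    have h2 : dist z (ratSymbol P Q x) * ‖M.D x‖ ≤ dist z (ratSymbol P Q x) * (‖M.D‖ + 1) := by
      gcongr
      exact (M.D.norm_coe_le_norm x).trans (by linarith)
    rw [lt_div_iff₀ (by positivity)] at hw
    linarith

theorem not_finiteDimensional_hardyPlus : ¬ FiniteDimensional ℂ hardyPlus := by
  intro h
  have h1 := (finrank_ker_coBlaschkeOp_pow (Module.finrank ℂ hardyPlus + 1)).2
  have h2 := Submodule.finrank_le (coBlaschkeOp ^ (Module.finrank ℂ hardyPlus + 1)).ker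
  omega

theorem mem_pointSpectrum_iff {H : Type*} [NormedAddCommGroup H] [InnerProductSpace ℂ H]
    (T : H →ₗ.[ℂ] H) (z : ℂ) : z ∈ pointSpectrum T ↔ kernel (shift T z) ≠ ⊥ := by
  rw [Submodule.ne_bot_iff]
  constructor
  · rintro ⟨f, hf, hTf⟩
    exact ⟨f, sub_eq_zero.2 hTf, hf⟩
  · rintro ⟨f, hTf, hf⟩
    exact ⟨f, hf, sub_eq_zero.1 hTf⟩

end WienerHopf

end

theorem mainTheorem5 (P Q : Polynomial ℂ) (hQ : Q ≠ 0) (hPQ : IsCoprime P Q) (z : ℂ)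
    (T : WienerHopf.hardyPlus →ₗ.[ℂ] WienerHopf.hardyPlus)
    (hT : T = WienerHopf.mPlus (WienerHopf.ratSymbol P Q))
    (Pz : Polynomial ℂ) (hPz : Pz = P - Polynomial.C z * Q) :
    (WienerHopf.IsFredholmPoint T z ↔ z ∉ closure (WienerHopf.ratRange P Q)) ∧
    (WienerHopf.IsFredholmPoint T z →
      (Module.finrank ℂ (WienerHopf.kernel (WienerHopf.shift T z)) : ℤ) =
          max 0 ((WienerHopf.degGT Q : ℤ) - WienerHopf.degGT Pz) ∧
      FiniteDimensional ℂ ↥(WienerHopf.range (WienerHopf.shift T z))ᗮ ∧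
      (Module.finrank ℂ ↥(WienerHopf.range (WienerHopf.shift T z))ᗮ : ℤ) =
          max 0 ((WienerHopf.degGT Pz : ℤ) - WienerHopf.degGT Q) ∧
      WienerHopf.index (WienerHopf.shift T z) =
          (WienerHopf.degGT Q : ℤ) - WienerHopf.degGT Pz) ∧
    (WienerHopf.IsRegularValue T z ↔
      z ∉ closure (WienerHopf.ratRange P Q) ∧ WienerHopf.degGT Q ≤ WienerHopf.degGT Pz) ∧
    (z ∈ WienerHopf.resolventSet T ↔
      z ∉ closure (WienerHopf.ratRange P Q) ∧ WienerHopf.degGT Q = WienerHopf.degGT Pz) ∧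
    (z ∈ WienerHopf.spectrum T ↔
      z ∈ closure (WienerHopf.ratRange P Q) ∨ WienerHopf.degGT Q ≠ WienerHopf.degGT Pz) ∧
    (z ∈ WienerHopf.pointSpectrum T ↔
      Pz = 0 ∨
        (WienerHopf.degLE Q < WienerHopf.degLT Pz ∧ WienerHopf.degGE Pz < WienerHopf.degGT Q)) ∧
    (z ∈ WienerHopf.continuousSpectrum T ↔
      Pz ≠ 0 ∧ z ∈ closure (WienerHopf.ratRange P Q) ∧
        WienerHopf.degGT Pz ≤ WienerHopf.degGT Q ∧
        (WienerHopf.degLT Pz ≤ WienerHopf.degLE Q ∨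
          WienerHopf.degGT Q ≤ WienerHopf.degGE Pz)) ∧
    (z ∈ WienerHopf.residualSpectrum T ↔ WienerHopf.degGT Q < WienerHopf.degGT Pz) := by
  open WienerHopf in
  subst hT
  have hspec : z ∈ spectrum (mPlus (ratSymbol P Q)) ↔
      ¬ z ∈ resolventSet (mPlus (ratSymbol P Q)) := Iff.rfl
  rw [hspec, mem_pointSpectrum_iff]
  set S := shift (mPlus (ratSymbol P Q)) z with hS
  change (IsFredholm S ↔ _) ∧ (IsFredholm S → _) ∧
    ((kernel S = ⊥ ∧ Continuous fun y : S.inverse.domain => S.inverse y) ↔ _) ∧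
    (((kernel S = ⊥ ∧ Continuous fun y : S.inverse.domain => S.inverse y) ∧ range S = ⊤) ↔ _) ∧
    ((¬ ((kernel S = ⊥ ∧ Continuous fun y : S.inverse.domain => S.inverse y) ∧
      range S = ⊤)) ↔ _) ∧ _ ∧
    (kernel S = ⊥ ∧ Dense (range S : Set hardyPlus) ∧ ¬ IsClosed (range S : Set hardyPlus) ↔ _) ∧
    (kernel S = ⊥ ∧ ¬ Dense (range S : Set hardyPlus) ↔ _)
  by_cases hR0 : Pz = 0
  · -- `T - z` is the zero operator on `H₊`
    have hF : FactorsThrough S (toep 1) (toep 0) := by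
      refine factorsThrough_of_symbol hQ z IsOuter.one isCoprime_one_left fun x => ?_
      rw [← hPz, hR0]
      simp
    have h0 : ∀ u, toep 0 u = 0 := fun u => by rw [toep_apply]; simp
    have hker : kernel S ≠ ⊥ := by
      rw [ne_eq, hF.kernel_eq_bot_iff]
      exact fun h => kerVec_ne_zero (h kerVec (h0 _))
    have hz : z ∈ closure (ratRange P Q) := by
      apply subset_closure
      obtain ⟨x, hx⟩ := (ae_eval_ne_zero hQ).exists
      refine ⟨x, hx, ?_⟩
      rw [ratSymbol, sub_eq_zero.1 (hPz.symm.trans hR0), eval_mul, eval_C]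
      field_simp
    have hnF : ¬ IsFredholm S := by
      intro h
      have := h.finite_kernel
      have h1 : FiniteDimensional ℂ (toep 0).ker := Module.Finite.equiv hF.kernelEquiv.symm
      have h2 : (toep 0).ker = ⊤ := by
        rw [eq_top_iff]
        exact fun u _ => h0 u
      rw [h2] at h1
      exact not_finiteDimensional_hardyPlus (Module.Finite.equiv (Submodule.topEquiv (R := ℂ)))
    have hdeg : degGT Pz = 0 := by
      rw [hR0, degGT, partIn]
      simp
    rw [hdeg]
    simp [hker, hz, hnF, hR0]
  · have hRQ : IsCoprime Pz Q := by
      rw [hPz, sub_eq_add_neg, ← neg_mul, IsCoprime.add_mul_right_left_iff]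
      exact hPQ
    obtain ⟨M, hM⟩ := exists_wienerHopfModel hQ hPz hR0 hRQ
    rw [← not_not (a := z ∈ closure _), notMem_closure_ratRange_iff hPz hRQ M hM, not_not]
    have hGT : ∀ P, degGT P = (zerosIn upper P).card := natDegree_partIn _
    have hLT : ∀ P, degLT P = (zerosIn lower P).card := natDegree_partIn _
    have hGE : ∀ P, degGE P = (zerosIn upper P).card + (zerosIn realLine P).card := fun P => by
      rw [← Multiset.card_add, ← zerosIn_nonneg]; exact natDegree_partIn _ _
    have hLE : ∀ P, degLE P = (zerosIn lower P).card + (zerosIn realLine P).card := fun P => by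
      rw [← Multiset.card_add, ← zerosIn_nonpos]; exact natDegree_partIn _ _
    have hdQ := natDegree_eq_card_add Q
    have hdR := natDegree_eq_card_add Pz
    rw [hGT, hGT, hLT, hGE, hLE]
    set r := (zerosIn upper Pz).card
    set s := (zerosIn upper Q).card
    set b := (zerosIn realLine Pz).card + (Q.natDegree - Pz.natDegree) with hb
    -- the two inequalities are `b' + r < s`, where `b'` arises from `b` if the truncated difference
    -- `deg Q - deg Pz` is replaced by the integer difference and by zero; the larger `b'` is `b`
    have hpoint : (zerosIn lower Q).card + (zerosIn realLine Q).card < (zerosIn lower Pz).card ∧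
        r + (zerosIn realLine Pz).card < s ↔ b + r < s := by omega
    have hfred : IsFredholm S ↔ b = 0 :=
      ⟨fun h => M.eq_zero_of_isClosed_range h.closed_range, fun h => (M.fredholm h).1⟩
    have hres : ((kernel S = ⊥ ∧ Continuous fun y : S.inverse.domain => S.inverse y) ∧
        range S = ⊤) ↔ b = 0 ∧ s = r := by
      rw [M.regular_iff]
      constructor
      · rintro ⟨⟨h1, h2⟩, h3⟩
        refine ⟨h1, le_antisymm h2 (M.dense_range_iff.1 ?_)⟩
        rw [h3]
        exact dense_univ
      · rintro ⟨h1, h2⟩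
        refine ⟨⟨h1, h2.le⟩, ?_⟩
        have hd := (M.dense_range_iff.2 h2.ge).closure_eq
        rw [(M.fredholm h1).1.closed_range.closure_eq] at hd
        exact SetLike.coe_injective hd
    refine ⟨hfred, fun h => ?_, M.regular_iff, hres, ?_, ?_, ?_, ?_⟩
    · obtain ⟨-, hk, hc⟩ := M.fredholm (hfred.1 h)
      have hcompl : CompleteSpace (range S) := h.closed_range.completeSpace_coe
      have := h.finite_cokernel
      have e := Submodule.quotientEquivOfIsCompl (range S) (range S)ᗮ
        (Submodule.isCompl_orthogonal _)
      refine ⟨?_, Module.Finite.equiv e, ?_, ?_⟩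
      · rw [hk]; omega
      · rw [← e.finrank_eq, hc]; omega
      · rw [index, hk, hc]; omega
    · rw [hres]; omega
    · rw [M.kernel_ne_bot_iff, ← hpoint]
      simp [hR0]
    · have hk := M.kernel_ne_bot_iff
      have hcl : IsClosed (range S : Set hardyPlus) ↔ b = 0 :=
        ⟨M.eq_zero_of_isClosed_range, fun h => (M.fredholm h).1.closed_range⟩
      rw [M.dense_range_iff, hcl, ← not_not (a := kernel S = ⊥), ← ne_eq, hk]
      simp only [ne_eq, hR0, not_false_eq_true, true_and]
      omega
    · have hk := M.kernel_ne_bot_iff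
      rw [M.dense_range_iff, ← not_not (a := kernel S = ⊥), ← ne_eq, hk]
      omega
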